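/- Let $d\ge 1$ and let $\rho$ be a probability measure on $\mathbb{R}^d$ which is symmetric (invariant under $x\mapsto -x$), non-degenerate ($\rho(H)<1$ for every affine hyperplane $H$ of $\mathbb{R}^d$) and satisfies $\int_{\mathbb{R}^d}\|z\|^5\,d\rho(z)<+\infty$. Let $\Sigma=\int_{\mathbb{R}^d} y\,{}^t\!y\,d\rho(y)$ be its covariance matrix and, for $z\in\mathbb{R}^d$, let \[M_4(z)=\sum_{1\le i,j,k,l\le d}\left(\int_{\mathbb{R}^d}y_iy_jy_ky_l\,d\rho(y)\right)z_iz_jz_kz_l .\] For $n\ge d$ and $x=(x_1,\dots,x_n)\in(\mathbb{R}^d)^n$ put $S_n=x_1+\dots+x_n$, $T_n=x_1\,{}^t\!x_1+\dots+x_n\,{}^t\!x_n$ and $D_n^+=\{x:\det T_n>0\}$, and let $\widetilde\mu_{n,\rho}$ be the measure on $(\mathbb{R}^d)^n$ with density \[\frac{1}{Z_n}\exp\left(\tfrac12\langle T_n^{-1}S_n,S_n\rangle\right)\mathbf{1}_{D_n^+}\] with respect to $\rho^{\otimes n}$, where $Z_n=\int_{D_n^+}\exp\left(\tfrac12\langle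 T_n^{-1}S_n,S_n\rangle\right)d\rho^{\otimes n}$. Then $0<Z_n<+\infty$ for all $n\ge d$ (so that $\widetilde\mu_{n,\rho}$ is a well-defined probability measure), $\Sigma$ is positive definite, the function $z\mapsto\exp\left(-\frac1{12}M_4(\Sigma^{-1/2}z)\right)$ is Lebesgue integrable on $\mathbb{R}^d$, and, under $\widetilde\mu_{n,\rho}$, \[\frac{1}{n^{1/4}}\,T_n^{-1/2}S_n\ \xrightarrow[n\to\infty]{\mathscr{L}}\ \frac{\exp\left(-\frac{1}{12}M_4\big(\Sigma^{-1/2}z\big)\right)dz}{\int_{\mathbb{R}^d}\exp\left(-\frac{1}{12}M_4\big(\Sigma^{-1/2}u\big)\right)du}\] in distribution, the limit being a probability measure on $\mathbb{R}^d$. Here, for a symmetric positive definite matrix $A$, $A^{-1/2}$ is the inverse of its positive square root. -/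

import Mathlib

open MeasureTheory ProbabilityTheory Filter Topology
open scoped ENNReal Matrix

namespace SOC

section InvSqrt

open scoped MatrixOrder

/-- `A ^ (-1/2)` for a symmetric positive definite matrix `A`: the inverse of the positive
semi-definite square root of `A`. -/
noncomputable def invSqrt {d : ℕ} (A : Matrix (Fin d) (Fin d) ℝ) : Matrix (Fin d) (Fin d) ℝ :=
  (CFC.sqrt A)⁻¹

end InvSqrt

/-- `ρ` is symmetric: it is invariant under `x ↦ -x`. -/
def IsSymmetric {d : ℕ} (ρ : Measure (EuclideanSpace ℝ (Fin d))) : Prop :=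
  ρ.map (fun x => -x) = ρ

/-- `ρ` is non-degenerate: it is not carried by any (affine) hyperplane of `ℝ^d`. -/
def IsNonDegenerate {d : ℕ} (ρ : Measure (EuclideanSpace ℝ (Fin d))) : Prop :=
  ∀ (u : EuclideanSpace ℝ (Fin d)) (c : ℝ), u ≠ 0 → ρ {x | inner ℝ u x = c} < 1

/-- The covariance matrix `∫ y yᵀ dρ(y)` of a symmetric (hence centred) measure `ρ`. -/
noncomputable def covMat {d : ℕ} (ρ : Measure (EuclideanSpace ℝ (Fin d))) :
    Matrix (Fin d) (Fin d) ℝ :=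
  Matrix.of fun i j => ∫ y, y i * y j ∂ρ

/-- The quartic form `M₄(z) = ∑_{i,j,k,l} (∫ y_i y_j y_k y_l dρ(y)) z_i z_j z_k z_l`. -/
noncomputable def M4 {d : ℕ} (ρ : Measure (EuclideanSpace ℝ (Fin d))) (z : Fin d → ℝ) : ℝ :=
  ∑ i, ∑ j, ∑ k, ∑ l, (∫ y, y i * y j * y k * y l ∂ρ) * (z i * z j * z k * z l)

/-- `S_n = x_1 + ⋯ + x_n`. -/
noncomputable def S {d n : ℕ} (x : Fin n → EuclideanSpace ℝ (Fin d)) : EuclideanSpace ℝ (Fin d) :=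
  ∑ i, x i

/-- `T_n = x_1 x_1ᵀ + ⋯ + x_n x_nᵀ`. -/
noncomputable def T {d n : ℕ} (x : Fin n → EuclideanSpace ℝ (Fin d)) :
    Matrix (Fin d) (Fin d) ℝ :=
  ∑ i, Matrix.vecMulVec (x i).ofLp (x i).ofLp

/-- The set `D_n⁺` of the configurations such that `det T_n > 0`. -/
def Dplus (d n : ℕ) : Set (Fin n → EuclideanSpace ℝ (Fin d)) :=
  {x | 0 < (T x).det}

/-- The unnormalized density `exp (⟨T_n⁻¹ S_n, S_n⟩ / 2)`. -/
noncomputable def weight {d n : ℕ} (x : Fin n → EuclideanSpace ℝ (Fin d)) : ℝ :=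
  Real.exp ((1 / 2) * (((T x)⁻¹ *ᵥ (S x).ofLp) ⬝ᵥ (S x).ofLp))

/-- The normalization constant `Z_n`, with values in `[0, ∞]`. -/
noncomputable def Z {d : ℕ} (ρ : Measure (EuclideanSpace ℝ (Fin d))) (n : ℕ) : ℝ≥0∞ :=
  ∫⁻ x in Dplus d n, ENNReal.ofReal (weight x) ∂(Measure.pi fun _ : Fin n => ρ)

/-- The law of the model: the measure on `(ℝ^d)^n` with density `weight / Z_n` on `D_n⁺` with
respect to `ρ^{⊗ n}`. -/
noncomputable def modelMeasure {d : ℕ} (ρ : Measure (EuclideanSpace ℝ (Fin d))) (n : ℕ) :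
    Measure (Fin n → EuclideanSpace ℝ (Fin d)) :=
  ((Measure.pi fun _ : Fin n => ρ).restrict (Dplus d n)).withDensity
    fun x => ENNReal.ofReal (weight x) / Z ρ n

/-- The rescaled sum `n^{-1/4} T_n^{-1/2} S_n`. -/
noncomputable def rescaledSum {d n : ℕ} (x : Fin n → EuclideanSpace ℝ (Fin d)) :
    EuclideanSpace ℝ (Fin d) :=
  (1 / (n : ℝ) ^ (1 / 4 : ℝ)) • WithLp.toLp 2 (invSqrt (T x) *ᵥ (S x).ofLp)

/-- The function `z ↦ exp (-M₄(Σ^{-1/2} z) / 12)`. -/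
noncomputable def limitWeight {d : ℕ} (ρ : Measure (EuclideanSpace ℝ (Fin d)))
    (z : EuclideanSpace ℝ (Fin d)) : ℝ :=
  Real.exp (-(1 / 12) * M4 ρ (invSqrt (covMat ρ) *ᵥ z.ofLp))

/-- The limiting law, whose Lebesgue density is `limitWeight` divided by its integral. -/
noncomputable def limitLaw {d : ℕ} (ρ : Measure (EuclideanSpace ℝ (Fin d))) :
    Measure (EuclideanSpace ℝ (Fin d)) :=
  volume.withDensity fun z => ENNReal.ofReal (limitWeight ρ z / ∫ u, limitWeight ρ u)

end SOC

/-! Write W = T_n^{-1/2} S_n, Y_i = T_n^{-1/2} x_i and r = n^{1/4}. On D_n⁺ the weight is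
exp(‖W‖²/2), and linearizing this square (Hubbard–Stratonovich) means adding to W/r an independent
Gaussian of covariance r⁻² I. Up to a constant, the sum has density E[exp(r⟨z,W⟩ - r²‖z‖²/2); D_n⁺]
under ρ^{⊗n} (`smoothedDensity`, `integral_mul_smoothedDensity`).

T_n is unchanged when signs of observations are flipped, so by symmetry of ρ the exponential may be
averaged over all signs, giving ∏ cosh(r⟨z,Y_i⟩). Since ∑⟨z,Y_i⟩² = ‖z‖², the Gaussian factor splits
over the same indices and the density becomes E[exp(-∑ g(r⟨z,Y_i⟩)); D_n⁺] with g(t) = t²/2 - log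
cosh t ≥ 0 (`smoothedDensity_eq`). The quadratic terms have cancelled exactly, and g(t) ~ t⁴/12 at
0.

By the law of large numbers T_n/n → Σ, so r⟨z,Y_i⟩ is close to n^{-1/4}⟨Σ^{-1/2}z, x_i⟩ and the sum
tends to M₄(Σ^{-1/2}z)/12; the fifth moment controls the remainder (`tendsto_sum_coshGap`). As the
integrand is at most 1, the densities converge pointwise. The bound g(t) ≥ c t⁴/(1+t²) and
Cauchy–Schwarz give a Gaussian bound uniform in n (`smoothedDensity_le`), so their Fourier
transforms converge too. The added Gaussian contributes only exp(-‖t‖²/(2r²)) → 1, and Lévy's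
theorem concludes. -/

namespace SOC

/-! ### Bounds for t²/2 - log cosh t. -/

section LogCosh

open Real

/-- The gap `t² / 2 - log (cosh t)` in the inequality `cosh t ≤ exp (t² / 2)`. -/
noncomputable def coshGap (t : ℝ) : ℝ := t ^ 2 / 2 - log (cosh t)

lemma exp_neg_coshGap (t : ℝ) : exp (-coshGap t) = exp (-(t ^ 2 / 2)) * cosh t := by
  rw [coshGap, neg_sub, sub_eq_neg_add, exp_add, exp_log (cosh_pos t)]

lemma coshGap_nonneg (t : ℝ) : 0 ≤ coshGap t := by
  have := log_le_log (cosh_pos t) (cosh_le_exp_half_sq t)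
  rw [log_exp] at this
  rw [coshGap]; linarith

lemma coshGap_abs (t : ℝ) : coshGap |t| = coshGap t := by
  simp [coshGap]

lemma continuous_coshGap : Continuous coshGap := by
  unfold coshGap
  exact (by fun_prop : Continuous fun t : ℝ => t ^ 2 / 2).sub
    (continuous_cosh.log fun t => (cosh_pos t).ne')

lemma hasDerivAt_tanh_real (t : ℝ) : HasDerivAt tanh (1 - tanh t ^ 2) t := by
  have h := (hasDerivAt_sinh t).div (hasDerivAt_cosh t) (cosh_pos t).ne'
  have h' : tanh = fun y => sinh y / cosh y := funext tanh_eq_sinh_div_cosh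
  rw [h']
  refine h.congr_deriv ?_
  have := (cosh_pos t).ne'
  field_simp

lemma hasDerivAt_coshGap (t : ℝ) : HasDerivAt coshGap (t - tanh t) t := by
  have h := ((hasDerivAt_id t).pow 2).div_const 2 |>.sub
    ((hasDerivAt_cosh t).log (cosh_pos t).ne')
  refine h.congr_deriv ?_
  simp [tanh_eq_sinh_div_cosh]

lemma nonneg_of_hasDerivAt_nonneg {f f' : ℝ → ℝ} (h0 : f 0 = 0)
    (hf : ∀ x, HasDerivAt f (f' x) x) (hf' : ∀ x, 0 ≤ x → 0 ≤ f' x) {x : ℝ} (hx : 0 ≤ x) :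
    0 ≤ f x := by
  have hmono : MonotoneOn f (Set.Ici 0) := by
    refine monotoneOn_of_deriv_nonneg (convex_Ici 0)
      (fun y _ => (hf y).continuousAt.continuousWithinAt)
      (fun y _ => (hf y).differentiableAt.differentiableWithinAt) fun y hy => ?_
    rw [interior_Ici] at hy
    rw [(hf y).deriv]
    exact hf' y (le_of_lt hy)
  rw [← h0]
  exact hmono (Set.mem_Ici.2 le_rfl) hx hx

lemma tanh_nonneg_real {t : ℝ} (ht : 0 ≤ t) : 0 ≤ tanh t := by
  rw [tanh_eq_sinh_div_cosh]
  exact div_nonneg (sinh_nonneg_iff.2 ht) (cosh_pos t).le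

lemma tanh_le_self {t : ℝ} (ht : 0 ≤ t) : tanh t ≤ t := by
  have := nonneg_of_hasDerivAt_nonneg (f := fun t => t - tanh t)
    (f' := fun t => 1 - (1 - tanh t ^ 2)) (by simp)
    (fun x => (hasDerivAt_id x).sub (hasDerivAt_tanh_real x))
    (fun x _ => by nlinarith [sq_nonneg (tanh x)]) ht
  linarith

/-- Because tanh' = 1 - tanh², an upper bound on tanh integrates to a lower bound and conversely;
each Taylor bound is bootstrapped from the previous one. -/
lemma sub_cube_le_tanh {t : ℝ} (ht : 0 ≤ t) : t - t ^ 3 / 3 ≤ tanh t := by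
  have := nonneg_of_hasDerivAt_nonneg (f := fun t => tanh t - (t - t ^ 3 / 3))
    (f' := fun t => (1 - tanh t ^ 2) - (1 - t ^ 2)) (by simp)
    (fun x => ((hasDerivAt_tanh_real x).sub ((hasDerivAt_id x).sub
      (((hasDerivAt_id x).pow 3).div_const 3))).congr_deriv (by simp))
    (fun x hx => by
      have h1 := tanh_le_self hx
      have h2 := tanh_nonneg_real hx
      nlinarith) ht
  linarith

lemma tanh_le_quintic {t : ℝ} (ht : 0 ≤ t) : tanh t ≤ t - t ^ 3 / 3 + 2 * t ^ 5 / 15 := by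
  have := nonneg_of_hasDerivAt_nonneg
    (f := fun t => (t - t ^ 3 / 3 + 2 * t ^ 5 / 15) - tanh t)
    (f' := fun t => (1 - t ^ 2 + 2 * t ^ 4 / 3) - (1 - tanh t ^ 2)) (by simp)
    (fun x => ((((hasDerivAt_id x).sub (((hasDerivAt_id x).pow 3).div_const 3)).add
      ((((hasDerivAt_id x).pow 5).const_mul 2).div_const 15)).sub
      (hasDerivAt_tanh_real x)).congr_deriv (by simp; ring))
    (fun x hx => by
      have h1 := sub_cube_le_tanh hx
      have h2 := tanh_nonneg_real hx
      -- The lower bound x - x³/3 can be squared only while it is nonnegative; beyond that 2x⁴/3 ≥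
      -- x² already suffices.
      rcases le_total (x ^ 2) 3 with h | h
      · have h3 : 0 ≤ x - x ^ 3 / 3 := by nlinarith
        nlinarith [pow_le_pow_left₀ h3 h1 2, pow_nonneg hx 6]
      · nlinarith [sq_nonneg (tanh x), sq_nonneg x]) ht
  linarith

lemma coshGap_le (t : ℝ) : coshGap t ≤ t ^ 4 / 12 := by
  have := nonneg_of_hasDerivAt_nonneg (f := fun t => t ^ 4 / 12 - coshGap t)
    (f' := fun t => t ^ 3 / 3 - (t - tanh t)) (by simp [coshGap])
    (fun x => ((((hasDerivAt_id x).pow 4).div_const 12).sub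
      (hasDerivAt_coshGap x)).congr_deriv (by simp; ring))
    (fun x hx => by have := sub_cube_le_tanh hx; linarith) (abs_nonneg t)
  simp only [coshGap_abs, Even.pow_abs (by decide : Even 4)] at this
  linarith

lemma le_coshGap_sextic (t : ℝ) : t ^ 4 / 12 - t ^ 6 / 45 ≤ coshGap t := by
  have := nonneg_of_hasDerivAt_nonneg (f := fun t => coshGap t - (t ^ 4 / 12 - t ^ 6 / 45))
    (f' := fun t => (t - tanh t) - (t ^ 3 / 3 - 2 * t ^ 5 / 15)) (by simp [coshGap])
    (fun x => ((hasDerivAt_coshGap x).sub ((((hasDerivAt_id x).pow 4).div_const 12).sub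
      (((hasDerivAt_id x).pow 6).div_const 45))).congr_deriv (by simp; ring))
    (fun x hx => by have := tanh_le_quintic hx; linarith) (abs_nonneg t)
  simp only [coshGap_abs, Even.pow_abs (by decide : Even 4),
    Even.pow_abs (by decide : Even 6)] at this
  linarith

/-- The natural error is sextic, but only five moments of ρ are available. For |t| ≤ 1 the sixth
power is below the fifth; for |t| ≥ 1 both terms lie in [0, t⁴/12]. -/
lemma abs_coshGap_sub_le (t : ℝ) : |coshGap t - t ^ 4 / 12| ≤ |t| ^ 5 := by
  have h1 := coshGap_le t
  have h2 := le_coshGap_sextic t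
  have h3 := coshGap_nonneg t
  rw [← Even.pow_abs (by decide : Even 4)] at *
  rw [← Even.pow_abs (by decide : Even 6)] at h2
  set s := |t|
  have hs : 0 ≤ s := abs_nonneg t
  rw [abs_le]
  constructor
  · rcases le_total s 1 with h | h
    · have : s ^ 6 ≤ s ^ 5 := pow_le_pow_of_le_one hs h (by norm_num)
      nlinarith [pow_nonneg hs 5]
    · have : s ^ 4 ≤ s ^ 5 := pow_le_pow_right₀ h (by norm_num)
      nlinarith [pow_nonneg hs 5]
  · nlinarith [pow_nonneg hs 5]

lemma monotoneOn_coshGap : MonotoneOn coshGap (Set.Ici 0) := by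
  refine monotoneOn_of_deriv_nonneg (convex_Ici 0) continuous_coshGap.continuousOn
    (fun y _ => (hasDerivAt_coshGap y).differentiableAt.differentiableWithinAt) fun y hy => ?_
  rw [interior_Ici] at hy
  rw [(hasDerivAt_coshGap y).deriv]
  have := tanh_le_self (le_of_lt (Set.mem_Ioi.1 hy))
  linarith

/-- The gap is quartic at 0 and quadratic at infinity. The shape u²/(1+u) with u = t² captures both
and suits the Cauchy–Schwarz inequality for sums of fractions. -/
lemma coshGap_ge (t : ℝ) : (t ^ 2) ^ 2 / (1 + t ^ 2) / 320 ≤ coshGap t := by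
  rw [← coshGap_abs, ← sq_abs t]
  set s := |t|
  have hs : 0 ≤ s := abs_nonneg t
  have hd : (0 : ℝ) < 1 + s ^ 2 := by positivity
  rw [div_div, div_le_iff₀ (by positivity)]
  have small : ∀ u : ℝ, 0 ≤ u → u ≤ 1 → u ^ 4 / 20 ≤ coshGap u := fun u h0 h1 => by
    have := le_coshGap_sextic u
    have h6 : u ^ 6 ≤ u ^ 4 := pow_le_pow_of_le_one h0 h1 (by norm_num)
    linarith [pow_nonneg h0 4]
  rcases le_total s 1 with h | h
  · nlinarith [small s hs h, pow_nonneg hs 4, pow_nonneg hs 6, coshGap_nonneg s]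
  -- On [1,4], monotonicity gives a gap of at least 1/20, and s² ≤ 16 yields 320 = 20 · 16; past 4
  -- the gap is at least s²/2 - s.
  · have key : s ^ 2 / 320 ≤ coshGap s := by
      rcases le_total s 4 with h4 | h4
      · have h1 := small 1 zero_le_one le_rfl
        have h2 := monotoneOn_coshGap (Set.mem_Ici.2 zero_le_one) (Set.mem_Ici.2 hs) h
        nlinarith
      · have hc : log (cosh s) ≤ s := by
          rw [log_le_iff_le_exp (cosh_pos s), cosh_eq]
          have : exp (-s) ≤ exp s := exp_le_exp.2 (by linarith)
          linarith
        rw [coshGap]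
        nlinarith
    nlinarith [pow_nonneg hs 2]

end LogCosh

/-! ### Continuity and homogeneity of A^{-1/2}. -/

section InvSqrtLemmas

open scoped MatrixOrder

variable {d : ℕ}

section Continuity

open scoped Matrix.Norms.L2Operator

lemma continuousOn_sqrt :
    ContinuousOn (CFC.sqrt : Matrix (Fin d) (Fin d) ℝ → _) {A | A.PosSemidef} := by
  have := ContinuousOn.cfcₙ_nnreal_of_mem_nhdsSet (A := Matrix (Fin d) (Fin d) ℝ)
    (s := Set.univ) NNReal.sqrt (a := id) (t := {A | A.PosSemidef}) Filter.univ_mem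
    continuousOn_id (fun A hA => hA.nonneg)
  exact this

end Continuity

variable {A : Matrix (Fin d) (Fin d) ℝ}

lemma det_sqrt_ne_zero (hA : A.PosDef) : (CFC.sqrt A).det ≠ 0 := fun h => by
  have h1 := congrArg Matrix.det (CFC.sqrt_mul_sqrt_self A hA.posSemidef.nonneg)
  rw [Matrix.det_mul, h, zero_mul] at h1
  exact hA.det_pos.ne h1

lemma continuousOn_invSqrt :
    ContinuousOn (invSqrt : Matrix (Fin d) (Fin d) ℝ → _) {A | A.PosDef} := by
  have hs : ContinuousOn (CFC.sqrt : Matrix (Fin d) (Fin d) ℝ → _) {A | A.PosDef} :=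
    continuousOn_sqrt.mono fun A hA => Matrix.PosDef.posSemidef hA
  have : (invSqrt : Matrix (Fin d) (Fin d) ℝ → _) =
      fun A => (CFC.sqrt A).det⁻¹ • (CFC.sqrt A).adjugate := by
    funext A
    rw [invSqrt, Matrix.inv_def, Ring.inverse_eq_inv']
  rw [this]
  exact ((Continuous.matrix_det continuous_id).comp_continuousOn hs |>.inv₀
    fun A hA => det_sqrt_ne_zero hA).smul
      ((Continuous.matrix_adjugate continuous_id).comp_continuousOn hs)

lemma transpose_invSqrt (A : Matrix (Fin d) (Fin d) ℝ) : (invSqrt A)ᵀ = invSqrt A := by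
  have h : (CFC.sqrt A)ᵀ = CFC.sqrt A := by
    have := (Matrix.nonneg_iff_posSemidef.1 (CFC.sqrt_nonneg A)).isHermitian
    rwa [Matrix.IsHermitian, Matrix.conjTranspose_eq_transpose_of_trivial] at this
  rw [invSqrt, Matrix.transpose_nonsing_inv, h]

lemma invSqrt_mul_self (hA : A.PosSemidef) : invSqrt A * invSqrt A = A⁻¹ := by
  rw [invSqrt, ← Matrix.mul_inv_rev, CFC.sqrt_mul_sqrt_self A hA.nonneg]

lemma invSqrt_mul_mul_invSqrt (hA : A.PosDef) : invSqrt A * A * invSqrt A = 1 := by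
  have h := det_sqrt_ne_zero hA
  have hu : IsUnit (CFC.sqrt A).det := isUnit_iff_ne_zero.2 h
  nth_rw 2 [← CFC.sqrt_mul_sqrt_self A hA.posSemidef.nonneg]
  rw [invSqrt, ← mul_assoc, Matrix.nonsing_inv_mul _ hu, one_mul, Matrix.mul_nonsing_inv _ hu]

lemma invSqrt_smul (hA : A.PosSemidef) {c : ℝ} (hc : 0 < c) :
    invSqrt (c • A) = (√c)⁻¹ • invSqrt A := by
  have h : CFC.sqrt (c • A) = √c • CFC.sqrt A := by
    refine CFC.sqrt_unique ?_ ?_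
    · rw [smul_mul_smul_comm, Real.mul_self_sqrt hc.le, CFC.sqrt_mul_sqrt_self A hA.nonneg]
    · exact smul_nonneg (Real.sqrt_nonneg c) (CFC.sqrt_nonneg A)
  have hs : √c ≠ 0 := (Real.sqrt_pos.2 hc).ne'
  rw [invSqrt, h, invSqrt]
  by_cases hu : IsUnit (CFC.sqrt A).det
  · let := invertibleOfNonzero hs
    rw [Matrix.inv_smul _ _ hu, invOf_eq_inv]
  -- For singular A both inverses take the default value 0.
  · have h0 : (CFC.sqrt A).det = 0 := by simpa using hu
    rw [Matrix.nonsing_inv_apply_not_isUnit _ hu, smul_zero,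
      Matrix.nonsing_inv_apply_not_isUnit]
    simp [h0]

end InvSqrtLemmas

/-! ### Self-normalized observations and sign changes. -/

section Configuration

variable {d n : ℕ}

/-- The self-normalized sum `T_n^{-1/2} S_n`. -/
noncomputable def normSum (x : Fin n → EuclideanSpace ℝ (Fin d)) : EuclideanSpace ℝ (Fin d) :=
  WithLp.toLp 2 (invSqrt (T x) *ᵥ (S x).ofLp)

/-- The self-normalized observation `T_n^{-1/2} x_i`. -/
noncomputable def normObs (x : Fin n → EuclideanSpace ℝ (Fin d)) (i : Fin n) :
    EuclideanSpace ℝ (Fin d) :=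
  WithLp.toLp 2 (invSqrt (T x) *ᵥ (x i).ofLp)

lemma normSum_eq_sum (x : Fin n → EuclideanSpace ℝ (Fin d)) :
    normSum x = ∑ i, normObs x i := by
  simp only [normSum, normObs, S, WithLp.ofLp_sum, Matrix.mulVec_sum, WithLp.toLp_sum]

lemma inner_normObs (x : Fin n → EuclideanSpace ℝ (Fin d)) (i : Fin n)
    (z : EuclideanSpace ℝ (Fin d)) :
    inner ℝ z (normObs x i) = (invSqrt (T x) *ᵥ z.ofLp) ⬝ᵥ (x i).ofLp := by
  rw [EuclideanSpace.inner_eq_star_dotProduct, star_trivial, normObs, dotProduct_comm,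
    Matrix.dotProduct_mulVec, ← Matrix.mulVec_transpose, transpose_invSqrt]

lemma dotProduct_T_mulVec (x : Fin n → EuclideanSpace ℝ (Fin d)) (v : Fin d → ℝ) :
    v ⬝ᵥ (T x *ᵥ v) = ∑ i, (v ⬝ᵥ (x i).ofLp) ^ 2 := by
  simp only [T, Matrix.sum_mulVec, dotProduct_sum, Matrix.vecMulVec_mulVec]
  refine Finset.sum_congr rfl fun i _ => ?_
  simp [dotProduct_comm v, sq]

lemma posSemidef_T (x : Fin n → EuclideanSpace ℝ (Fin d)) : (T x).PosSemidef := by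
  refine Matrix.PosSemidef.of_dotProduct_mulVec_nonneg ?_ fun v => ?_
  · rw [Matrix.IsHermitian, Matrix.conjTranspose_eq_transpose_of_trivial, T,
      Matrix.transpose_sum]
    simp [Matrix.transpose_vecMulVec]
  · rw [star_trivial, dotProduct_T_mulVec]
    positivity

lemma mem_Dplus_iff (x : Fin n → EuclideanSpace ℝ (Fin d)) : x ∈ Dplus d n ↔ (T x).PosDef :=
  ⟨fun h => (posSemidef_T x).posDef_iff_det_ne_zero.2 (ne_of_gt h), fun h => h.det_pos⟩

lemma continuous_T : Continuous (T : (Fin n → EuclideanSpace ℝ (Fin d)) → _) := by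
  unfold T
  refine continuous_finsetSum _ fun i _ => ?_
  refine Continuous.matrix_vecMulVec ?_ ?_ <;> fun_prop

lemma isOpen_Dplus : IsOpen (Dplus d n) :=
  isOpen_lt continuous_const continuous_T.matrix_det

lemma measurableSet_Dplus : MeasurableSet (Dplus d n) := isOpen_Dplus.measurableSet

lemma continuousOn_invSqrt_T_mulVec
    {u : (Fin n → EuclideanSpace ℝ (Fin d)) → EuclideanSpace ℝ (Fin d)} (hu : Continuous u) :
    ContinuousOn (fun x => WithLp.toLp 2 (invSqrt (T x) *ᵥ (u x).ofLp)) (Dplus d n) := by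
  have h1 : ContinuousOn (fun x : Fin n → EuclideanSpace ℝ (Fin d) => invSqrt (T x))
      (Dplus d n) :=
    continuousOn_invSqrt.comp continuous_T.continuousOn fun x hx => (mem_Dplus_iff x).1 hx
  have h2 : Continuous (fun x : Fin n → EuclideanSpace ℝ (Fin d) => (u x).ofLp) := by fun_prop
  have h3 : Continuous fun p : Matrix (Fin d) (Fin d) ℝ × (Fin d → ℝ) =>
      WithLp.toLp 2 (p.1 *ᵥ p.2) :=
    (PiLp.continuous_toLp 2 _).comp (continuous_fst.matrix_mulVec continuous_snd)
  exact h3.comp_continuousOn (h1.prodMk h2.continuousOn)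

lemma continuousOn_normSum :
    ContinuousOn (normSum : (Fin n → EuclideanSpace ℝ (Fin d)) → _) (Dplus d n) :=
  continuousOn_invSqrt_T_mulVec (u := S) (by unfold S; fun_prop)

lemma continuousOn_normObs (i : Fin n) :
    ContinuousOn (fun x : Fin n → EuclideanSpace ℝ (Fin d) => normObs x i) (Dplus d n) :=
  continuousOn_invSqrt_T_mulVec (continuous_apply i)

section Positive

variable {x : Fin n → EuclideanSpace ℝ (Fin d)} (hx : x ∈ Dplus d n)
include hx

/-- The normalized observations form a Parseval frame, since T^{-1/2} T T^{-1/2} = 1. -/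
lemma sum_inner_normObs_sq (z : EuclideanSpace ℝ (Fin d)) :
    ∑ i, inner ℝ z (normObs x i) ^ 2 = ‖z‖ ^ 2 := by
  simp only [inner_normObs, ← dotProduct_T_mulVec]
  rw [← real_inner_self_eq_norm_sq, EuclideanSpace.inner_eq_star_dotProduct, star_trivial]
  rw [Matrix.mulVec_mulVec, dotProduct_comm, Matrix.dotProduct_mulVec, ← Matrix.mulVec_transpose,
    transpose_invSqrt, Matrix.mulVec_mulVec, ← mul_assoc,
    invSqrt_mul_mul_invSqrt ((mem_Dplus_iff x).1 hx), Matrix.one_mulVec]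

/-- Cauchy–Schwarz together with the Parseval identity at z = W gives ‖W‖⁴ ≤ n‖W‖². This
deterministic bound makes the weight bounded on D_n⁺. -/
lemma norm_normSum_sq_le : ‖normSum x‖ ^ 2 ≤ n := by
  have h : ‖normSum x‖ ^ 2 = ∑ i, inner ℝ (normSum x) (normObs x i) := by
    rw [← inner_sum, ← normSum_eq_sum, real_inner_self_eq_norm_sq]
  have h2 := sq_sum_le_card_mul_sum_sq (s := Finset.univ)
    (f := fun i => inner ℝ (normSum x) (normObs x i))
  rw [← h, sum_inner_normObs_sq hx, Finset.card_univ, Fintype.card_fin] at h2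
  rcases (sq_nonneg ‖normSum x‖).eq_or_lt with h0 | h0
  · rw [← h0]; positivity
  · exact le_of_mul_le_mul_right (by linarith) h0

omit hx in
lemma weight_eq : weight x = Real.exp (‖normSum x‖ ^ 2 / 2) := by
  rw [weight, ← real_inner_self_eq_norm_sq, EuclideanSpace.inner_eq_star_dotProduct, star_trivial,
    normSum, Matrix.dotProduct_mulVec, ← Matrix.mulVec_transpose, transpose_invSqrt,
    Matrix.mulVec_mulVec, invSqrt_mul_self (posSemidef_T x)]
  ring_nf

lemma exp_neg_sum_coshGap (r : ℝ) (z : EuclideanSpace ℝ (Fin d)) :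
    Real.exp (-∑ i, coshGap (r * inner ℝ z (normObs x i))) =
      Real.exp (-(r ^ 2 / 2 * ‖z‖ ^ 2)) * ∏ i, Real.cosh (r * inner ℝ z (normObs x i)) := by
  rw [← Finset.sum_neg_distrib, Real.exp_sum]
  simp only [exp_neg_coshGap, Finset.prod_mul_distrib, ← Real.exp_sum]
  rw [← sum_inner_normObs_sq hx z, Finset.mul_sum, ← Finset.sum_neg_distrib]
  congr 2
  refine Finset.sum_congr rfl fun i _ => ?_
  ring

/-- Source of the domination: with a_i = (r⟨z,Y_i⟩)², ∑ a_i²/(1+a_i) ≥ (∑ a_i)²/(n + ∑ a_i) and ∑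
a_i = r²‖z‖², so the bound no longer depends on the configuration. -/
lemma le_sum_coshGap {r : ℝ} (hn : 1 ≤ n) (hr : (r ^ 2) ^ 2 = n) (z : EuclideanSpace ℝ (Fin d)) :
    (‖z‖ ^ 2 - 1) / 320 ≤ ∑ i, coshGap (r * inner ℝ z (normObs x i)) := by
  have h1 : ∑ i, (r * inner ℝ z (normObs x i)) ^ 2 = r ^ 2 * ‖z‖ ^ 2 := by
    simp only [mul_pow, ← Finset.mul_sum, sum_inner_normObs_sq hx]
  have h2 := Finset.sq_sum_div_le_sum_sq_div Finset.univ
    (fun i => (r * inner ℝ z (normObs x i)) ^ 2)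
    (g := fun i => 1 + (r * inner ℝ z (normObs x i)) ^ 2) (fun i _ => by positivity)
  rw [Finset.sum_add_distrib, h1, Finset.sum_const, Finset.card_univ, Fintype.card_fin,
    nsmul_eq_mul, mul_one] at h2
  have h3 : ∑ i, ((r * inner ℝ z (normObs x i)) ^ 2) ^ 2 /
      (1 + (r * inner ℝ z (normObs x i)) ^ 2) / 320 ≤
      ∑ i, coshGap (r * inner ℝ z (normObs x i)) :=
    Finset.sum_le_sum fun i _ => coshGap_ge _
  rw [← Finset.sum_div] at h3
  refine le_trans (div_le_div_of_nonneg_right (le_trans ?_ h2) (by norm_num)) h3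
  have hn' : (1 : ℝ) ≤ n := by exact_mod_cast hn
  have hrn : r ^ 2 ≤ n := by nlinarith [sq_nonneg r]
  have hz : 0 ≤ ‖z‖ ^ 2 := sq_nonneg _
  set s := ‖z‖ ^ 2
  rw [le_div_iff₀ (by nlinarith [sq_nonneg r]), mul_pow, hr]
  -- The claim is (s-1)(n + r²s) ≤ n s². For s ≥ 1, r² ≤ n bounds the left side by n(s²-1); for s ≤
  -- 1 it is nonpositive.
  rcases le_total s 1 with h | h
  · nlinarith [mul_nonneg (sq_nonneg r) hz, mul_nonneg (by linarith : (0:ℝ) ≤ n) (sq_nonneg s)]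
  · nlinarith [mul_nonneg (sub_nonneg.2 h) (mul_nonneg (sub_nonneg.2 hrn) hz)]

end Positive

/-- Change of signs of the observations. -/
def signFlip (ε : Fin n → Bool) (x : Fin n → EuclideanSpace ℝ (Fin d)) :
    Fin n → EuclideanSpace ℝ (Fin d) :=
  fun i => if ε i then x i else -x i

lemma T_signFlip (ε : Fin n → Bool) (x : Fin n → EuclideanSpace ℝ (Fin d)) :
    T (signFlip ε x) = T x := by
  unfold T
  refine Finset.sum_congr rfl fun i _ => ?_
  cases h : ε i <;> simp [signFlip, h, Matrix.neg_vecMulVec, Matrix.vecMulVec_neg]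

lemma inner_normSum_signFlip (ε : Fin n → Bool) (x : Fin n → EuclideanSpace ℝ (Fin d))
    (z : EuclideanSpace ℝ (Fin d)) :
    inner ℝ z (normSum (signFlip ε x)) =
      ∑ i, if ε i then inner ℝ z (normObs x i) else -inner ℝ z (normObs x i) := by
  rw [normSum_eq_sum, inner_sum]
  refine Finset.sum_congr rfl fun i _ => ?_
  cases h : ε i <;> simp [inner_normObs, T_signFlip, signFlip, h]

lemma signFlip_involutive (ε : Fin n → Bool) :
    Function.Involutive (signFlip ε : (Fin n → EuclideanSpace ℝ (Fin d)) → _) := fun x => by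
  funext i
  cases h : ε i <;> simp [signFlip, h]

lemma measurable_signFlip (ε : Fin n → Bool) :
    Measurable (signFlip ε : (Fin n → EuclideanSpace ℝ (Fin d)) → _) := by
  refine measurable_pi_lambda _ fun i => ?_
  cases h : ε i <;> simp [signFlip, h] <;> fun_prop

/-- Expand the product of the factors exp(s i) + exp(-s i). -/
lemma sum_exp_signs_eq_prod_cosh (s : Fin n → ℝ) :
    ∑ ε : Fin n → Bool, Real.exp (∑ i, if ε i then s i else -s i) =
      2 ^ n * ∏ i, Real.cosh (s i) := by
  have h := Finset.prod_univ_sum (fun _ : Fin n => (Finset.univ : Finset Bool))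
    (fun i b => Real.exp (if b then s i else -s i))
  rw [Fintype.piFinset_univ] at h
  simp only [Real.exp_sum, ← h, Fintype.sum_bool]
  simp [Real.cosh_eq, Finset.prod_div_distrib]
  field_simp

end Configuration

/-! ### Averaging over signs under ρ^{⊗n}. -/

section Symmetrization

variable {d n : ℕ} {ρ : Measure (EuclideanSpace ℝ (Fin d))} [IsProbabilityMeasure ρ]

lemma measurePreserving_signFlip (hsymm : IsSymmetric ρ) (ε : Fin n → Bool) :
    MeasurePreserving (signFlip ε) ((Measure.pi fun _ : Fin n => ρ).restrict (Dplus d n))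
      ((Measure.pi fun _ : Fin n => ρ).restrict (Dplus d n)) := by
  have h : MeasurePreserving (signFlip ε) (Measure.pi fun _ : Fin n => ρ)
      (Measure.pi fun _ : Fin n => ρ) := by
    refine measurePreserving_pi _ _ (f := fun i y => if ε i then y else -y) fun i => ?_
    cases h : ε i
    · simpa using ⟨measurable_neg, hsymm⟩
    · simp only [if_true]; exact MeasurePreserving.id ρ
  have h2 := h.restrict_preimage (measurableSet_Dplus (d := d) (n := n))
  have h3 : signFlip ε ⁻¹' Dplus d n = Dplus d n := by
    ext x; simp [Dplus, T_signFlip]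
  rwa [h3] at h2

lemma aemeasurable_normSum (μ : Measure (Fin n → EuclideanSpace ℝ (Fin d))) :
    AEMeasurable normSum (μ.restrict (Dplus d n)) :=
  continuousOn_normSum.aemeasurable measurableSet_Dplus

lemma inner_normSum_le {x : Fin n → EuclideanSpace ℝ (Fin d)} (hx : x ∈ Dplus d n)
    (z : EuclideanSpace ℝ (Fin d)) : |inner ℝ z (normSum x)| ≤ ‖z‖ * √n :=
  (abs_real_inner_le_norm _ _).trans
    (mul_le_mul_of_nonneg_left (Real.le_sqrt_of_sq_le (norm_normSum_sq_le hx)) (norm_nonneg z))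

lemma integrable_exp_inner_normSum (r : ℝ) (z : EuclideanSpace ℝ (Fin d)) :
    Integrable (fun x => Real.exp (r * inner ℝ z (normSum x)))
      ((Measure.pi fun _ : Fin n => ρ).restrict (Dplus d n)) := by
  refine Integrable.of_bound (C := Real.exp (|r| * (‖z‖ * √n))) ?_ ?_
  · have := aemeasurable_normSum (Measure.pi fun _ : Fin n => ρ)
    exact AEMeasurable.aestronglyMeasurable (by fun_prop)
  · refine (ae_restrict_iff' measurableSet_Dplus).2 (.of_forall fun x hx => ?_)
    rw [Real.norm_eq_abs, Real.abs_exp, Real.exp_le_exp]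
    refine (le_abs_self _).trans ?_
    rw [abs_mul]
    exact mul_le_mul_of_nonneg_left (inner_normSum_le hx z) (abs_nonneg r)

/-- Averaging over the signs turns the exponential of the self-normalized sum into a product of
hyperbolic cosines. -/
lemma setIntegral_exp_inner_normSum (hsymm : IsSymmetric ρ) (r : ℝ)
    (z : EuclideanSpace ℝ (Fin d)) :
    ∫ x in Dplus d n, Real.exp (r * inner ℝ z (normSum x)) ∂(Measure.pi fun _ : Fin n => ρ) =
      ∫ x in Dplus d n, ∏ i, Real.cosh (r * inner ℝ z (normObs x i))
        ∂(Measure.pi fun _ : Fin n => ρ) := by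
  set μ := (Measure.pi fun _ : Fin n => ρ).restrict (Dplus d n)
  set f : (Fin n → EuclideanSpace ℝ (Fin d)) → ℝ := fun x => Real.exp (r * inner ℝ z (normSum x))
  have hemb (ε : Fin n → Bool) :
      MeasurableEmbedding (signFlip ε : (Fin n → EuclideanSpace ℝ (Fin d)) → _) :=
    (MeasurableEquiv.ofInvolutive _ (signFlip_involutive ε)
      (measurable_signFlip ε)).measurableEmbedding
  have h1 (ε : Fin n → Bool) : ∫ x, f (signFlip ε x) ∂μ = ∫ x, f x ∂μ :=
    (measurePreserving_signFlip hsymm ε).integral_comp (hemb ε) f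
  have h2 (ε : Fin n → Bool) : Integrable (fun x => f (signFlip ε x)) μ :=
    ((measurePreserving_signFlip hsymm ε).integrable_comp_emb (hemb ε)).2
      (integrable_exp_inner_normSum r z)
  have h3 : ∫ x, ∑ ε : Fin n → Bool, f (signFlip ε x) ∂μ = 2 ^ n * ∫ x, f x ∂μ := by
    rw [integral_finsetSum _ fun ε _ => h2 ε]
    simp [h1]
  have h4 (x : Fin n → EuclideanSpace ℝ (Fin d)) : ∑ ε : Fin n → Bool, f (signFlip ε x) =
      2 ^ n * ∏ i, Real.cosh (r * inner ℝ z (normObs x i)) := by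
    rw [← sum_exp_signs_eq_prod_cosh]
    refine Finset.sum_congr rfl fun ε _ => ?_
    simp only [f, inner_normSum_signFlip, Finset.mul_sum, mul_ite, mul_neg]
  simp only [h4, integral_const_mul] at h3
  exact (mul_left_cancel₀ (by positivity) h3).symm

end Symmetrization

/-! ### Gaussian integrals. -/

section Gaussian

variable {d : ℕ}

/-- Gaussian linearization of `exp (‖w‖² / 2)`, with a Fourier factor. -/
lemma integral_cexp_gaussian (w t : EuclideanSpace ℝ (Fin d)) {r : ℝ} (hr : 0 < r) :
    ∫ z : EuclideanSpace ℝ (Fin d),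
      Complex.exp (inner ℝ z t * Complex.I) *
        (Real.exp (r * inner ℝ z w - r ^ 2 / 2 * ‖z‖ ^ 2) : ℝ) =
    (2 * Real.pi / r ^ 2 : ℂ) ^ (d / 2 : ℂ) * Complex.exp (-(‖t‖ ^ 2 / (2 * r ^ 2))) *
      ((Real.exp (‖w‖ ^ 2 / 2) : ℝ) * Complex.exp (inner ℝ w t / r * Complex.I)) := by
  have hr' : (r : ℂ) ≠ 0 := by exact_mod_cast hr.ne'
  have hb : 0 < ((r : ℂ) ^ 2 / 2).re := by
    have : ((r : ℂ) ^ 2 / 2) = ((r ^ 2 / 2 : ℝ) : ℂ) := by push_cast; ring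
    rw [this, Complex.ofReal_re]; positivity
  have key := GaussianFourier.integral_cexp_neg_mul_sum_add (ι := Fin d) hb
    (fun i => (r * w i + t i * Complex.I : ℂ))
  rw [← (PiLp.volume_preserving_toLp (Fin d)).integral_comp
    (MeasurableEquiv.toLp 2 _).measurableEmbedding]
  have hsq (v : EuclideanSpace ℝ (Fin d)) : ((‖v‖ : ℂ)) ^ 2 = ∑ i, (v i : ℂ) ^ 2 := by
    have := EuclideanSpace.real_norm_sq_eq v
    exact_mod_cast this
  have hin (u v : EuclideanSpace ℝ (Fin d)) : ((inner ℝ u v : ℝ) : ℂ) = ∑ i, (u i : ℂ) * v i := by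
    rw [PiLp.inner_apply]
    push_cast
    exact Finset.sum_congr rfl fun i _ => by simp [mul_comm]
  calc _ = _ := ?_
    _ = _ := key
    _ = _ := ?_
  · refine integral_congr_ae (.of_forall fun v => ?_)
    simp only
    rw [Complex.ofReal_exp, ← Complex.exp_add]
    push_cast
    rw [hsq, hin, hin]
    simp only [add_mul, Finset.sum_add_distrib, Finset.mul_sum, Finset.sum_mul]
    congr 1
    rw [sub_eq_add_neg, ← add_assoc, add_comm, ← Finset.sum_neg_distrib]
    congr 1
    · exact Finset.sum_congr rfl fun i _ => by ring
    · rw [add_comm]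
      congr 1
      · exact Finset.sum_congr rfl fun i _ => by ring
      · exact Finset.sum_congr rfl fun i _ => by ring
  · rw [mul_assoc, Complex.ofReal_exp, ← Complex.exp_add, ← Complex.exp_add, Fintype.card_fin]
    push_cast
    rw [hsq, hsq, hin]
    congr 2
    · field_simp
    · simp only [add_sq, mul_pow, Complex.I_sq, Finset.sum_add_distrib]
      have e1 : ∑ i, (r : ℂ) ^ 2 * (w i : ℂ) ^ 2 = r ^ 2 * ∑ i, (w i : ℂ) ^ 2 := by
        rw [Finset.mul_sum]
      have e2 : ∑ i, 2 * ((r : ℂ) * w i) * (t i * Complex.I) =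
          2 * r * Complex.I * ∑ i, (w i : ℂ) * t i := by
        rw [Finset.mul_sum]; exact Finset.sum_congr rfl fun i _ => by ring
      have e3 : ∑ i, (t i : ℂ) ^ 2 * -1 = - ∑ i, (t i : ℂ) ^ 2 := by
        rw [← Finset.sum_neg_distrib]; exact Finset.sum_congr rfl fun i _ => by ring
      rw [e1, e2, e3]
      field_simp
      ring

lemma integrable_exp_neg_mul_sq_norm {b : ℝ} (hb : 0 < b) (c : ℝ) :
    Integrable fun z : EuclideanSpace ℝ (Fin d) => Real.exp (c - b * ‖z‖ ^ 2) := by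
  have h := (GaussianFourier.integrable_cexp_neg_mul_sq_norm_add
    (V := EuclideanSpace ℝ (Fin d)) (b := b) (by simpa using hb) 0 0).norm
  refine (h.const_mul (Real.exp c)).congr (.of_forall fun z => ?_)
  simp only [Complex.norm_exp]
  rw [← Real.exp_add]
  congr 1
  have : (-(b : ℂ) * (‖z‖ : ℂ) ^ 2 + 0 * ((inner ℝ (0 : EuclideanSpace ℝ (Fin d)) z : ℝ) : ℂ)) =
    ((-b * ‖z‖ ^ 2 : ℝ) : ℂ) := by push_cast; ring
  rw [this, Complex.ofReal_re]; ring

end Gaussian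

/-! ### The smoothed density and its Fourier transform. -/

section Linearization

variable {d n : ℕ} (ρ : Measure (EuclideanSpace ℝ (Fin d)))

/-- Up to a constant factor, the density of the law of the sum of `normSum / r` under the
unnormalized model and of an independent centred Gaussian vector of covariance `r⁻²`. -/
noncomputable def smoothedDensity (n : ℕ) (r : ℝ) (z : EuclideanSpace ℝ (Fin d)) : ℝ :=
  ∫ x in Dplus d n, Real.exp (r * inner ℝ z (normSum x) - r ^ 2 / 2 * ‖z‖ ^ 2)
    ∂(Measure.pi fun _ : Fin n => ρ)

/-- Symmetrization replaces an integrand that may be huge by one bounded by 1, with the quadratic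
part of the exponent removed. -/
lemma smoothedDensity_eq [IsProbabilityMeasure ρ] (hsymm : IsSymmetric ρ) (r : ℝ)
    (z : EuclideanSpace ℝ (Fin d)) :
    smoothedDensity ρ n r z =
      ∫ x in Dplus d n, Real.exp (-∑ i, coshGap (r * inner ℝ z (normObs x i)))
        ∂(Measure.pi fun _ : Fin n => ρ) := by
  rw [setIntegral_congr_fun measurableSet_Dplus fun x hx => exp_neg_sum_coshGap hx r z,
    integral_const_mul, ← setIntegral_exp_inner_normSum hsymm, ← integral_const_mul,
    smoothedDensity]
  refine integral_congr_ae (.of_forall fun x => ?_)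
  simp only
  rw [← Real.exp_add]
  ring_nf

lemma integrable_linearized [IsProbabilityMeasure ρ] {r : ℝ} (hr : 0 < r)
    (t : EuclideanSpace ℝ (Fin d)) :
    Integrable (fun p : (Fin n → EuclideanSpace ℝ (Fin d)) × EuclideanSpace ℝ (Fin d) =>
      Complex.exp (inner ℝ p.2 t * Complex.I) *
        (Real.exp (r * inner ℝ p.2 (normSum p.1) - r ^ 2 / 2 * ‖p.2‖ ^ 2) : ℝ))
      (((Measure.pi fun _ : Fin n => ρ).restrict (Dplus d n)).prod volume) := by
  have hb : Integrable (fun p : (Fin n → EuclideanSpace ℝ (Fin d)) × EuclideanSpace ℝ (Fin d) =>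
      Real.exp (n - r ^ 2 / 4 * ‖p.2‖ ^ 2))
      (((Measure.pi fun _ : Fin n => ρ).restrict (Dplus d n)).prod volume) :=
    (integrable_exp_neg_mul_sq_norm (by positivity) _).comp_snd _
  refine hb.mono' ?_ ?_
  · have : AEMeasurable (fun p : (Fin n → EuclideanSpace ℝ (Fin d)) × EuclideanSpace ℝ (Fin d) =>
        normSum p.1) (((Measure.pi fun _ : Fin n => ρ).restrict (Dplus d n)).prod volume) :=
      (aemeasurable_normSum _).comp_fst
    refine AEMeasurable.aestronglyMeasurable (AEMeasurable.mul ?_ ?_)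
    · exact Continuous.aemeasurable (by fun_prop)
    · exact Complex.measurable_ofReal.comp_aemeasurable (by fun_prop)
  · have hD : ∀ᵐ p ∂(((Measure.pi fun _ : Fin n => ρ).restrict (Dplus d n)).prod
        (volume : Measure (EuclideanSpace ℝ (Fin d)))), p.1 ∈ Dplus d n :=
      Measure.quasiMeasurePreserving_fst.ae (ae_restrict_mem measurableSet_Dplus)
    filter_upwards [hD] with p hp
    rw [norm_mul, Complex.norm_exp_ofReal_mul_I, one_mul, Complex.norm_real, Real.norm_eq_abs,
      Real.abs_exp, Real.exp_le_exp]
    have h1 := (le_abs_self _).trans (inner_normSum_le hp p.2)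
    have h2 : √(n : ℝ) ^ 2 = n := Real.sq_sqrt (Nat.cast_nonneg n)
    -- Young's inequality: r‖z‖√n ≤ r²‖z‖²/4 + n, which leaves half of the Gaussian decay.
    nlinarith [sq_nonneg (r * ‖p.2‖ / 2 - √n), mul_le_mul_of_nonneg_left h1 hr.le]

/-- The unnormalized characteristic function of `normSum / r` under the model. -/
noncomputable def weightedCharFun (n : ℕ) (r : ℝ) (t : EuclideanSpace ℝ (Fin d)) : ℂ :=
  ∫ x in Dplus d n, (weight x : ℂ) * Complex.exp (inner ℝ (normSum x) t / r * Complex.I)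
    ∂(Measure.pi fun _ : Fin n => ρ)

lemma integral_mul_smoothedDensity [IsProbabilityMeasure ρ] {r : ℝ} (hr : 0 < r)
    (t : EuclideanSpace ℝ (Fin d)) :
    ∫ z, Complex.exp (inner ℝ z t * Complex.I) * (smoothedDensity ρ n r z : ℂ) =
      (2 * Real.pi / r ^ 2 : ℂ) ^ (d / 2 : ℂ) * Complex.exp (-(‖t‖ ^ 2 / (2 * r ^ 2))) *
        weightedCharFun ρ n r t := by
  have h := integral_integral_swap
    (f := fun (x : Fin n → EuclideanSpace ℝ (Fin d)) (z : EuclideanSpace ℝ (Fin d)) =>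
      Complex.exp (inner ℝ z t * Complex.I) *
        (Real.exp (r * inner ℝ z (normSum x) - r ^ 2 / 2 * ‖z‖ ^ 2) : ℝ))
    (integrable_linearized ρ (n := n) hr t)
  simp only [integral_cexp_gaussian _ _ hr, integral_const_mul, ← weight_eq] at h
  rw [weightedCharFun, h]
  refine integral_congr_ae (.of_forall fun z => ?_)
  simp only [smoothedDensity]
  rw [← integral_complex_ofReal]

lemma aestronglyMeasurable_smoothedDensity [IsProbabilityMeasure ρ] {r : ℝ}
    (hr : 0 < r) :
    AEStronglyMeasurable (smoothedDensity ρ n r) volume := by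
  -- The norm removes the Fourier factor, leaving exactly the integrand of `smoothedDensity`.
  have h := (integrable_linearized ρ (n := n) hr 0).norm.swap.aestronglyMeasurable
  have h2 := h.integral_prod_right'
  refine h2.congr (.of_forall fun z => ?_)
  simp only [smoothedDensity, Function.comp_apply, Prod.swap_prod_mk, norm_mul,
    Complex.norm_exp_ofReal_mul_I, one_mul, Complex.norm_real, Real.norm_eq_abs, Real.abs_exp]

end Linearization

/-! ### Moments of ρ and positivity of Σ. -/

section Moments

variable {d : ℕ} {ρ : Measure (EuclideanSpace ℝ (Fin d))}

lemma abs_apply_le_norm (y : EuclideanSpace ℝ (Fin d)) (i : Fin d) : |y i| ≤ ‖y‖ :=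
  PiLp.norm_apply_le y i

section Integrability

variable [IsProbabilityMeasure ρ] (h5 : Integrable (fun z => ‖z‖ ^ 5) ρ)
include h5

lemma integrable_of_le_norm_pow {f : EuclideanSpace ℝ (Fin d) → ℝ} (hf : Continuous f) {k : ℕ}
    (hk : k ≤ 5) (hle : ∀ y, |f y| ≤ ‖y‖ ^ k) : Integrable f ρ := by
  refine ((integrable_const (1 : ℝ)).add h5).mono' hf.aestronglyMeasurable
    (.of_forall fun y => (hle y).trans ?_)
  simp only [Pi.add_apply]
  rcases le_total ‖y‖ 1 with h | h
  · have := pow_le_one₀ (n := k) (norm_nonneg y) h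
    have := pow_nonneg (norm_nonneg y) 5
    linarith
  · have := pow_le_pow_right₀ h hk
    linarith

lemma integrable_mul_apply (i j : Fin d) : Integrable (fun y => y i * y j) ρ := by
  refine integrable_of_le_norm_pow h5 (by fun_prop) (k := 2) (by norm_num) fun y => ?_
  rw [abs_mul, sq]
  gcongr <;> exact abs_apply_le_norm y _

lemma integrable_quartic_apply (i j k l : Fin d) :
    Integrable (fun y => y i * y j * y k * y l) ρ := by
  refine integrable_of_le_norm_pow h5 (by fun_prop) (k := 4) (by norm_num) fun y => ?_
  rw [abs_mul, abs_mul, abs_mul, show ‖y‖ ^ 4 = ‖y‖ * ‖y‖ * ‖y‖ * ‖y‖ by ring]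
  gcongr <;> exact abs_apply_le_norm y _

/-- The quadratic form at v is ∫⟨v,y⟩² dρ; if it vanished for some v ≠ 0, ρ would be carried by the
hyperplane orthogonal to v. -/
lemma posDef_covMat (hnd : IsNonDegenerate ρ) : (covMat ρ).PosDef := by
  have hq (v : Fin d → ℝ) :
      v ⬝ᵥ (covMat ρ *ᵥ v) = ∫ y, inner ℝ (WithLp.toLp 2 v) y ^ 2 ∂ρ := by
    have h1 (y : EuclideanSpace ℝ (Fin d)) :
        inner ℝ (WithLp.toLp 2 v) y ^ 2 = ∑ i, ∑ j, v i * (y i * y j * v j) := by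
      rw [PiLp.inner_apply, sq, Finset.sum_mul_sum]
      refine Finset.sum_congr rfl fun i _ => Finset.sum_congr rfl fun j _ => ?_
      simp; ring
    simp only [h1]
    rw [integral_finsetSum _ fun i _ => integrable_finsetSum _ fun j _ =>
      ((integrable_mul_apply h5 i j).mul_const _).const_mul _]
    simp only [dotProduct, Matrix.mulVec, covMat, Matrix.of_apply, Finset.mul_sum]
    refine Finset.sum_congr rfl fun i _ => ?_
    rw [integral_finsetSum _ fun j _ => ((integrable_mul_apply h5 i j).mul_const _).const_mul _]
    simp only [integral_const_mul, integral_mul_const]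
  refine Matrix.PosDef.of_dotProduct_mulVec_pos ?_ fun v hv => ?_
  · ext i j
    simp [covMat, mul_comm]
  · rw [star_trivial, hq]
    refine lt_of_le_of_ne (integral_nonneg fun y => sq_nonneg _) fun h0 => ?_
    have hint : Integrable (fun y => inner ℝ (WithLp.toLp 2 v) y ^ 2) ρ := by
      refine ((integrable_of_le_norm_pow h5 (f := fun y => ‖y‖ ^ 2) (by fun_prop) (k := 2)
        (by norm_num) fun y => by simp).const_mul
          (‖(WithLp.toLp 2 v : EuclideanSpace ℝ (Fin d))‖ ^ 2)).mono' ?_ ?_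
      · exact Continuous.aestronglyMeasurable (by fun_prop)
      · refine .of_forall fun y => ?_
        rw [Real.norm_eq_abs, abs_pow, ← mul_pow]
        exact pow_le_pow_left₀ (abs_nonneg _) (abs_real_inner_le_norm _ _) 2
    have h1 := (integral_eq_zero_iff_of_nonneg (fun y => sq_nonneg _) hint).1 h0.symm
    have h2 : ∀ᵐ y ∂ρ, inner ℝ (WithLp.toLp 2 v) y = 0 := by
      filter_upwards [h1] with y hy
      simpa using hy
    refine (hnd (WithLp.toLp 2 v) 0 fun h => hv ?_).ne (prob_compl_eq_zero_iff₀ ?_ |>.1 h2)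
    · simpa using h
    · exact (measurableSet_eq_fun (by fun_prop) (by fun_prop)).nullMeasurableSet

end Integrability

lemma dotProduct_pow_four (v : Fin d → ℝ) (y : EuclideanSpace ℝ (Fin d)) :
    (v ⬝ᵥ y.ofLp) ^ 4 =
      ∑ i, ∑ j, ∑ k, ∑ l, (y i * y j * y k * y l) * (v i * v j * v k * v l) := by
  have h (i j k l : Fin d) : (y i * y j * y k * y l) * (v i * v j * v k * v l) =
      (v i * y i) * ((v j * y j) * ((v k * y k) * (v l * y l))) := by ring
  simp only [h, ← Finset.mul_sum, ← Finset.sum_mul, dotProduct]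
  ring

lemma continuous_M4 : Continuous (M4 ρ) := by
  unfold M4; fun_prop

lemma continuous_limitWeight : Continuous (limitWeight ρ) := by
  have : Continuous fun z : EuclideanSpace ℝ (Fin d) => invSqrt (covMat ρ) *ᵥ z.ofLp :=
    Continuous.matrix_mulVec continuous_const (by fun_prop)
  exact Real.continuous_exp.comp (continuous_const.mul (continuous_M4.comp this))

end Moments

/-! ### Pointwise convergence by the law of large numbers. -/

section Pointwise

variable {d : ℕ} {ρ : Measure (EuclideanSpace ℝ (Fin d))}

lemma ae_tendsto_empirical_mean [IsProbabilityMeasure ρ] {f : EuclideanSpace ℝ (Fin d) → ℝ}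
    (hf : Measurable f) (hint : Integrable f ρ) :
    ∀ᵐ ω ∂(Measure.infinitePi fun _ : ℕ => ρ),
      Tendsto (fun n : ℕ => (∑ i : Fin n, f (ω i)) / n) atTop (𝓝 (∫ y, f y ∂ρ)) := by
  have hmp (i : ℕ) := measurePreserving_eval_infinitePi (fun _ : ℕ => ρ) i
  have hident (i : ℕ) : IdentDistrib (fun ω : ℕ → EuclideanSpace ℝ (Fin d) => f (ω i)) f
      (Measure.infinitePi fun _ : ℕ => ρ) ρ :=
    ⟨(hf.comp (measurable_pi_apply i)).aemeasurable, hf.aemeasurable, by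
      conv_rhs => rw [← (hmp i).map_eq]
      rw [Measure.map_map hf (hmp i).measurable]
      rfl⟩
  have h := strong_law_ae_real (μ := Measure.infinitePi fun _ : ℕ => ρ)
    (fun i (ω : ℕ → EuclideanSpace ℝ (Fin d)) => f (ω i))
    ((hmp 0).integrable_comp_of_integrable hint)
    (fun i j hij => (iIndepFun_infinitePi (P := fun _ : ℕ => ρ) (X := fun _ => f)
      fun _ => hf).indepFun hij)
    (fun i => (hident i).trans (hident 0).symm)
  have he : (∫ ω, f (ω 0) ∂(Measure.infinitePi fun _ : ℕ => ρ)) = ∫ y, f y ∂ρ :=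
    (hident 0).integral_eq
  filter_upwards [h] with ω hω
  rw [he] at hω
  simpa only [Finset.sum_range] using hω

section Deterministic

variable {ω : ℕ → EuclideanSpace ℝ (Fin d)}
  (h2 : ∀ i j, Tendsto (fun n : ℕ => (∑ m : Fin n, ω m i * ω m j) / n) atTop
    (𝓝 (∫ y, y i * y j ∂ρ)))
include h2

lemma tendsto_smul_T : Tendsto (fun n : ℕ => (n : ℝ)⁻¹ • T fun i : Fin n => ω i) atTop
    (𝓝 (covMat ρ)) := by
  refine tendsto_pi_nhds.2 fun i => tendsto_pi_nhds.2 fun j => ?_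
  refine (h2 i j).congr fun n => ?_
  simp [T, Matrix.sum_apply, Matrix.vecMulVec_apply, div_eq_inv_mul]

lemma eventually_posDef_smul_T (hcov : (covMat ρ).PosDef) :
    ∀ᶠ n : ℕ in atTop, ((n : ℝ)⁻¹ • T fun i : Fin n => ω i).PosDef := by
  have hdet : Tendsto (fun n : ℕ => ((n : ℝ)⁻¹ • T fun i : Fin n => ω i).det) atTop
      (𝓝 (covMat ρ).det) :=
    ((Continuous.matrix_det continuous_id).tendsto _).comp (tendsto_smul_T h2)
  filter_upwards [hdet.eventually (lt_mem_nhds hcov.det_pos)] with n hn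
  exact ((posSemidef_T _).smul (by positivity : (0 : ℝ) ≤ (n : ℝ)⁻¹)).posDef_iff_det_ne_zero.2
    (ne_of_gt hn)

lemma eventually_mem_Dplus (hcov : (covMat ρ).PosDef) :
    ∀ᶠ n : ℕ in atTop, (fun i : Fin n => ω i) ∈ Dplus d n := by
  filter_upwards [eventually_posDef_smul_T h2 hcov, eventually_gt_atTop 0] with n hn h0
  rw [mem_Dplus_iff]
  have h0' : (0 : ℝ) < n := by exact_mod_cast h0
  have := hn.smul h0'
  rwa [smul_smul, mul_inv_cancel₀ h0'.ne', one_smul] at this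

lemma tendsto_invSqrt_mulVec (hcov : (covMat ρ).PosDef) (z : EuclideanSpace ℝ (Fin d)) :
    Tendsto (fun n : ℕ => invSqrt ((n : ℝ)⁻¹ • T fun i : Fin n => ω i) *ᵥ z.ofLp) atTop
      (𝓝 (invSqrt (covMat ρ) *ᵥ z.ofLp)) := by
  have h : Tendsto (fun n : ℕ => invSqrt ((n : ℝ)⁻¹ • T fun i : Fin n => ω i)) atTop
      (𝓝 (invSqrt (covMat ρ))) :=
    (continuousOn_invSqrt _ hcov).tendsto.comp
      (tendsto_nhdsWithin_iff.2 ⟨tendsto_smul_T h2, eventually_posDef_smul_T h2 hcov⟩)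
  exact ((continuous_id.matrix_mulVec continuous_const).tendsto _).comp h

/-- The sum of the gaps along a configuration whose empirical moments converge. -/
lemma tendsto_sum_coshGap (hcov : (covMat ρ).PosDef)
    (h4 : ∀ i j k l, Tendsto (fun n : ℕ => (∑ m : Fin n, ω m i * ω m j * ω m k * ω m l) / n)
      atTop (𝓝 (∫ y, y i * y j * y k * y l ∂ρ)))
    {c : ℝ} (h5 : Tendsto (fun n : ℕ => (∑ m : Fin n, ‖ω m‖ ^ 5) / n) atTop (𝓝 c))
    (z : EuclideanSpace ℝ (Fin d)) :
    Tendsto (fun n : ℕ => ∑ i, coshGap ((n : ℝ) ^ (1 / 4 : ℝ) *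
        inner ℝ z (normObs (fun i : Fin n => ω i) i))) atTop
      (𝓝 (M4 ρ (invSqrt (covMat ρ) *ᵥ z.ofLp) / 12)) := by
  set v : ℕ → Fin d → ℝ := fun n => invSqrt ((n : ℝ)⁻¹ • T fun i : Fin n => ω i) *ᵥ z.ofLp with hv
  have hvlim := tendsto_invSqrt_mulVec h2 hcov z
  set r : ℕ → ℝ := fun n => (n : ℝ) ^ (1 / 4 : ℝ) with hr
  have hrlim : Tendsto r atTop atTop :=
    (tendsto_rpow_atTop (by norm_num)).comp tendsto_natCast_atTop_atTop
  have hr4 (n : ℕ) : r n ^ 4 = n := by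
    rw [hr, ← Real.rpow_natCast, ← Real.rpow_mul (Nat.cast_nonneg n)]; norm_num
  -- T_n^{-1/2} = n^{-1/2} (T_n/n)^{-1/2} and n^{1/2} = r², so the prefactor r turns into 1/r.
  have harg : ∀ n : ℕ, 0 < n → ∀ i : Fin n,
      r n * inner ℝ z (normObs (fun i : Fin n => ω i) i) = (r n)⁻¹ * (v n ⬝ᵥ (ω i).ofLp) := by
    intro n hn i
    have hn' : (0 : ℝ) < n := by exact_mod_cast hn
    have hrpos : 0 < r n := Real.rpow_pos_of_pos hn' _
    have hsq : √(n : ℝ)⁻¹ = (r n ^ 2)⁻¹ := by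
      rw [Real.sqrt_inv, ← hr4 n, show r n ^ 4 = (r n ^ 2) ^ 2 by ring,
        Real.sqrt_sq (by positivity)]
    rw [inner_normObs, hv]
    simp only
    rw [invSqrt_smul (posSemidef_T _) (by positivity), hsq, inv_inv, Matrix.smul_mulVec,
      smul_dotProduct, smul_eq_mul]
    field_simp
  have hmain : Tendsto (fun n : ℕ => ∑ i : Fin n,
      (r n * inner ℝ z (normObs (fun i : Fin n => ω i) i)) ^ 4 / 12) atTop
      (𝓝 (M4 ρ (invSqrt (covMat ρ) *ᵥ z.ofLp) / 12)) := by
    have hlim : Tendsto (fun n : ℕ => (∑ i, ∑ j, ∑ k, ∑ l,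
        ((∑ m : Fin n, ω m i * ω m j * ω m k * ω m l) / n) *
          (v n i * v n j * v n k * v n l)) / 12) atTop
        (𝓝 (M4 ρ (invSqrt (covMat ρ) *ᵥ z.ofLp) / 12)) := by
      have hvi (i : Fin d) := (tendsto_pi_nhds.1 hvlim) i
      refine Tendsto.div_const ?_ _
      refine tendsto_finsetSum _ fun i _ => tendsto_finsetSum _ fun j _ =>
        tendsto_finsetSum _ fun k _ => tendsto_finsetSum _ fun l _ => ?_
      exact (h4 i j k l).mul ((((hvi i).mul (hvi j)).mul (hvi k)).mul (hvi l))
    refine hlim.congr' ?_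
    filter_upwards [eventually_gt_atTop 0] with n hn
    simp only [harg n hn, ← Finset.sum_div, mul_pow, ← Finset.mul_sum, inv_pow, hr4]
    congr 1
    simp only [dotProduct_pow_four]
    have hcomm : ∑ m : Fin n, ∑ i, ∑ j, ∑ k, ∑ l,
        (ω m i * ω m j * ω m k * ω m l) * (v n i * v n j * v n k * v n l) =
        ∑ i, ∑ j, ∑ k, ∑ l, ∑ m : Fin n,
          (ω m i * ω m j * ω m k * ω m l) * (v n i * v n j * v n k * v n l) := by
      rw [Finset.sum_comm]
      refine Finset.sum_congr rfl fun i _ => ?_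
      rw [Finset.sum_comm]
      refine Finset.sum_congr rfl fun j _ => ?_
      rw [Finset.sum_comm]
      refine Finset.sum_congr rfl fun k _ => ?_
      rw [Finset.sum_comm]
    rw [hcomm]
    simp only [← Finset.sum_mul]
    simp only [Finset.mul_sum _ _ (n : ℝ)⁻¹]
    refine Finset.sum_congr rfl fun i _ => Finset.sum_congr rfl fun j _ =>
      Finset.sum_congr rfl fun k _ => Finset.sum_congr rfl fun l _ => ?_
    ring
  -- The remainder is at most r⁻⁵ ‖v_n‖⁵ ∑‖ω_i‖⁵ = r⁻¹ ‖v_n‖⁵ · (∑‖ω_i‖⁵)/n, which is O(1/r).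
  have herr : Tendsto (fun n : ℕ => ∑ i : Fin n,
      (coshGap (r n * inner ℝ z (normObs (fun i : Fin n => ω i) i)) -
      (r n * inner ℝ z (normObs (fun i : Fin n => ω i) i)) ^ 4 / 12)) atTop (𝓝 0) := by
    have hN : Tendsto (fun n => ‖(WithLp.toLp 2 (v n) : EuclideanSpace ℝ (Fin d))‖) atTop
        (𝓝 ‖(WithLp.toLp 2 (invSqrt (covMat ρ) *ᵥ z.ofLp) : EuclideanSpace ℝ (Fin d))‖) :=
      ((PiLp.continuous_toLp 2 _).norm.tendsto _).comp hvlim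
    have hb := (hrlim.inv_tendsto_atTop.mul (hN.pow 5)).mul h5
    rw [zero_mul, zero_mul] at hb
    refine squeeze_zero_norm' ?_ hb
    filter_upwards [eventually_gt_atTop 0] with n hn
    have hn' : (0 : ℝ) < n := by exact_mod_cast hn
    have hrpos : 0 < r n := Real.rpow_pos_of_pos hn' _
    refine (norm_sum_le _ _).trans ?_
    calc _ ≤ ∑ i : Fin n, (r n)⁻¹ ^ 5 *
          (‖(WithLp.toLp 2 (v n) : EuclideanSpace ℝ (Fin d))‖ ^ 5 * ‖ω i‖ ^ 5) := by
          refine Finset.sum_le_sum fun i _ => ?_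
          rw [Real.norm_eq_abs]
          refine (abs_coshGap_sub_le _).trans ?_
          rw [harg n hn, abs_mul, mul_pow, abs_of_pos (inv_pos.2 hrpos), ← mul_pow ‖_‖]
          refine mul_le_mul_of_nonneg_left (pow_le_pow_left₀ (abs_nonneg _) ?_ 5) (by positivity)
          have := abs_real_inner_le_norm (WithLp.toLp 2 (v n)) (ω i)
          rwa [EuclideanSpace.inner_eq_star_dotProduct, star_trivial, dotProduct_comm] at this
      _ = _ := by
          rw [← Finset.mul_sum, ← Finset.mul_sum]
          simp only [Pi.inv_apply]
          rw [show (r n)⁻¹ ^ 5 = (r n)⁻¹ * (r n ^ 4)⁻¹ by field_simp, hr4]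
          field_simp
  have := herr.add hmain
  rw [zero_add] at this
  refine this.congr fun n => ?_
  rw [← Finset.sum_add_distrib]
  exact Finset.sum_congr rfl fun i _ => by ring

end Deterministic

lemma tendsto_smoothedDensity [IsProbabilityMeasure ρ] (hsymm : IsSymmetric ρ)
    (hnd : IsNonDegenerate ρ) (h5 : Integrable (fun z => ‖z‖ ^ 5) ρ)
    (z : EuclideanSpace ℝ (Fin d)) :
    Tendsto (fun n : ℕ => smoothedDensity ρ n ((n : ℝ) ^ (1 / 4 : ℝ)) z) atTop
      (𝓝 (limitWeight ρ z)) := by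
  set F : (n : ℕ) → (Fin n → EuclideanSpace ℝ (Fin d)) → ℝ := fun n x =>
    Real.exp (-∑ i, coshGap ((n : ℝ) ^ (1 / 4 : ℝ) * inner ℝ z (normObs x i))) with hF
  have hcov := posDef_covMat h5 hnd
  have hFm (n : ℕ) (μ : Measure (Fin n → EuclideanSpace ℝ (Fin d))) :
      AEStronglyMeasurable ((Dplus d n).indicator (F n)) μ := by
    refine (aestronglyMeasurable_indicator_iff measurableSet_Dplus).2
      (ContinuousOn.aestronglyMeasurable ?_ measurableSet_Dplus)
    refine Real.continuous_exp.comp_continuousOn (ContinuousOn.neg ?_)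
    refine continuousOn_finsetSum _ fun i _ => continuous_coshGap.comp_continuousOn ?_
    exact continuousOn_const.mul (continuousOn_const.inner (continuousOn_normObs i))
  have hmp (n : ℕ) : MeasurePreserving
      (fun (ω : ℕ → EuclideanSpace ℝ (Fin d)) (i : Fin n) => ω i)
      (Measure.infinitePi fun _ : ℕ => ρ) (Measure.pi fun _ : Fin n => ρ) := by
    refine ⟨by fun_prop, ?_⟩
    rw [← Measure.infinitePi_eq_pi]
    exact Measure.map_infinitePi_infinitePi_of_inj (P := fun _ : ℕ => ρ) Fin.val_injective
  -- All n are realized on one space of infinite samples, so that almost sure convergence and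
  -- domination by 1 apply.
  have heq (n : ℕ) : smoothedDensity ρ n ((n : ℝ) ^ (1 / 4 : ℝ)) z =
      ∫ ω, (Dplus d n).indicator (F n) (fun i : Fin n => ω i)
        ∂(Measure.infinitePi fun _ : ℕ => ρ) := by
    rw [smoothedDensity_eq ρ hsymm, ← integral_indicator measurableSet_Dplus, ← (hmp n).map_eq,
      integral_map (hmp n).measurable.aemeasurable (hFm n _)]
  simp only [heq]
  have hlim : limitWeight ρ z =
      ∫ _, limitWeight ρ z ∂(Measure.infinitePi fun _ : ℕ => ρ) := by simp
  rw [hlim]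
  refine tendsto_integral_of_dominated_convergence (fun _ => 1)
    (fun n => ((hFm n _).comp_measurePreserving (hmp n))) (integrable_const _)
    (fun n => .of_forall fun ω => ?_) ?_
  · refine (norm_indicator_le_norm_self _ _).trans ?_
    rw [hF, Real.norm_eq_abs, Real.abs_exp, Real.exp_le_one_iff, neg_nonpos]
    exact Finset.sum_nonneg fun i _ => coshGap_nonneg _
  · have a2 := ae_all_iff.2 fun i => ae_all_iff.2 fun j =>
      ae_tendsto_empirical_mean (by fun_prop) (integrable_mul_apply h5 i j)
    have a4 := ae_all_iff.2 fun i => ae_all_iff.2 fun j => ae_all_iff.2 fun k =>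
      ae_all_iff.2 fun l =>
        ae_tendsto_empirical_mean (by fun_prop) (integrable_quartic_apply h5 i j k l)
    filter_upwards [a2, a4, ae_tendsto_empirical_mean (by fun_prop) h5] with ω b2 b4 b5
    have h := (Real.continuous_exp.tendsto _).comp (tendsto_sum_coshGap b2 hcov b4 b5 z).neg
    have e : Real.exp (-(M4 ρ (invSqrt (covMat ρ) *ᵥ z.ofLp) / 12)) = limitWeight ρ z := by
      rw [limitWeight]; congr 1; ring
    rw [e] at h
    refine h.congr' ?_
    filter_upwards [eventually_mem_Dplus b2 hcov] with n hn
    rw [Set.indicator_of_mem hn]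
    rfl

end Pointwise

/-! ### Positivity and finiteness of Z_n; the model's characteristic function. -/

section Normalization

variable {d : ℕ} {ρ : Measure (EuclideanSpace ℝ (Fin d))} [IsProbabilityMeasure ρ]

lemma span_support_eq_top (hnd : IsNonDegenerate ρ) : Submodule.span ℝ ρ.support = ⊤ := by
  by_contra h
  rw [← Submodule.orthogonal_eq_bot_iff] at h
  obtain ⟨u, hu, hu0⟩ := Submodule.exists_mem_ne_zero_of_ne_bot h
  refine (hnd u 0 hu0).ne (prob_compl_eq_zero_iff₀ ?_ |>.1 ?_)
  · exact (measurableSet_eq_fun (by fun_prop) (by fun_prop)).nullMeasurableSet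
  · refine measure_mono_null (Set.compl_subset_compl.2 fun x hx => ?_)
      (Measure.measure_compl_support (μ := ρ))
    exact (Submodule.mem_orthogonal' _ u).1 hu x (Submodule.subset_span hx)

/-- By non-degeneracy the support contains a basis; a configuration listing all its vectors has T
positive definite. As D_n⁺ is open, this point of the support gives it positive mass. -/
lemma exists_mem_Dplus_support (hd : 1 ≤ d) (hnd : IsNonDegenerate ρ) {n : ℕ} (hn : d ≤ n) :
    ∃ x ∈ Dplus d n, ∀ i, x i ∈ ρ.support := by
  obtain ⟨b, hbs, hspan, hli⟩ := exists_linearIndependent ℝ ρ.support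
  rw [span_support_eq_top hnd] at hspan
  have : Fintype b := hli.setFinite.fintype
  have hcard : Fintype.card b ≤ Fintype.card (Fin n) := by
    have := hli.fintype_card_le_finrank
    rw [finrank_euclideanSpace_fin] at this
    simpa using this.trans hn
  obtain ⟨e⟩ := Function.Embedding.nonempty_of_card_le hcard
  have : Nonempty (Fin d) := ⟨⟨0, hd⟩⟩
  have : Nonempty b := by
    by_contra hb
    rw [Set.nonempty_coe_sort, Set.not_nonempty_iff_eq_empty] at hb
    rw [hb, Submodule.span_empty] at hspan
    exact bot_ne_top hspan
  -- `Function.invFun e` maps the n indices onto the basis; surplus indices repeat a basis vector.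
  refine ⟨fun i => (Function.invFun e i : b), ?_, fun i => hbs (Subtype.coe_prop _)⟩
  rw [mem_Dplus_iff]
  refine Matrix.PosDef.of_dotProduct_mulVec_pos (posSemidef_T _).isHermitian fun v hv => ?_
  rw [star_trivial, dotProduct_T_mulVec]
  refine lt_of_le_of_ne (by positivity) fun h0 => hv ?_
  have h1 := (Finset.sum_eq_zero_iff_of_nonneg fun i _ => sq_nonneg _).1 h0.symm
  have h2 : (WithLp.toLp 2 v : EuclideanSpace ℝ (Fin d)) ∈ (Submodule.span ℝ b)ᗮ := by
    rw [Submodule.mem_orthogonal']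
    intro u hu
    induction hu using Submodule.span_induction with
    | mem y hy =>
      obtain ⟨i, hi⟩ := Function.invFun_surjective e.injective ⟨y, hy⟩
      have := h1 i (Finset.mem_univ i)
      rw [hi] at this
      rw [EuclideanSpace.inner_eq_star_dotProduct, star_trivial, dotProduct_comm]
      simpa using this
    | zero => simp
    | add _ _ _ _ h h' => rw [inner_add_right, h, h', add_zero]
    | smul c _ _ h => rw [inner_smul_right, h, mul_zero]
  rw [hspan, Submodule.top_orthogonal_eq_bot, Submodule.mem_bot] at h2
  simpa using h2

lemma measure_Dplus_pos (hd : 1 ≤ d) (hnd : IsNonDegenerate ρ) {n : ℕ} (hn : d ≤ n) :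
    0 < (Measure.pi fun _ : Fin n => ρ) (Dplus d n) := by
  obtain ⟨x, hx, hxs⟩ := exists_mem_Dplus_support hd hnd hn
  obtain ⟨u, hu, hsub⟩ := isOpen_pi_iff'.1 isOpen_Dplus x hx
  refine lt_of_lt_of_le ?_ (measure_mono hsub)
  rw [Measure.pi_pi]
  exact CanonicallyOrderedAdd.prod_pos.2 fun i _ =>
    (Measure.mem_support_iff_forall _).1 (hxs i) _ ((hu i).1.mem_nhds (hu i).2)

lemma Z_pos (hd : 1 ≤ d) (hnd : IsNonDegenerate ρ) {n : ℕ} (hn : d ≤ n) : 0 < Z ρ n := by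
  refine lt_of_lt_of_le (measure_Dplus_pos hd hnd hn) ?_
  rw [← setLIntegral_one, Z]
  refine lintegral_mono fun x => ?_
  rw [ENNReal.one_le_ofReal, weight_eq, Real.one_le_exp_iff]
  positivity

omit [IsProbabilityMeasure ρ] in
lemma Z_lt_top [IsFiniteMeasure ρ] (n : ℕ) : Z ρ n < ∞ := by
  have h : Z ρ n ≤ ∫⁻ _ in Dplus d n, ENNReal.ofReal (Real.exp (n / 2))
      ∂(Measure.pi fun _ : Fin n => ρ) := by
    refine setLIntegral_mono measurable_const fun x hx => ?_
    rw [weight_eq]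
    gcongr
    exact norm_normSum_sq_le hx
  refine h.trans_lt ?_
  rw [setLIntegral_const]
  exact ENNReal.mul_lt_top ENNReal.ofReal_lt_top (measure_lt_top _ _)

lemma isProbabilityMeasure_modelMeasure (hd : 1 ≤ d) (hnd : IsNonDegenerate ρ) {n : ℕ}
    (hn : d ≤ n) : IsProbabilityMeasure (modelMeasure ρ n) := by
  refine ⟨?_⟩
  have h0 := (Z_pos hd hnd hn).ne'
  rw [modelMeasure, withDensity_apply _ .univ, Measure.restrict_univ]
  simp only [div_eq_mul_inv]
  rw [lintegral_mul_const' _ _ (ENNReal.inv_ne_top.2 h0)]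
  exact ENNReal.mul_inv_cancel h0 (Z_lt_top n).ne

omit [IsProbabilityMeasure ρ] in
lemma aemeasurable_rescaledSum (n : ℕ) :
    AEMeasurable (rescaledSum : (Fin n → EuclideanSpace ℝ (Fin d)) → _) (modelMeasure ρ n) := by
  have h : (rescaledSum : (Fin n → EuclideanSpace ℝ (Fin d)) → _) =
      fun x => (1 / (n : ℝ) ^ (1 / 4 : ℝ)) • normSum x := rfl
  have hm := (aemeasurable_normSum (Measure.pi fun _ : Fin n => ρ)).const_smul
    (1 / (n : ℝ) ^ (1 / 4 : ℝ))
  rw [h]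
  exact hm.mono_ac (withDensity_absolutelyContinuous _ _)

omit [IsProbabilityMeasure ρ] in
lemma charFun_rescaledSum (n : ℕ) (hZ : Z ρ n ≠ 0) (t : EuclideanSpace ℝ (Fin d)) :
    charFun ((modelMeasure ρ n).map rescaledSum) t =
      ((Z ρ n).toReal : ℂ)⁻¹ * weightedCharFun ρ n ((n : ℝ) ^ (1 / 4 : ℝ)) t := by
  have hm : AEMeasurable (fun x => ENNReal.ofReal (weight x) / Z ρ n)
      ((Measure.pi fun _ : Fin n => ρ).restrict (Dplus d n)) := by
    have := aemeasurable_normSum (Measure.pi fun _ : Fin n => ρ)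
    simp only [weight_eq]
    fun_prop
  rw [charFun_apply, integral_map (aemeasurable_rescaledSum n)
    (Continuous.aestronglyMeasurable (by fun_prop)), modelMeasure,
    integral_withDensity_eq_integral_toReal_smul₀ hm
      (.of_forall fun x => ENNReal.div_lt_top ENNReal.ofReal_ne_top hZ),
    weightedCharFun, ← integral_const_mul]
  refine integral_congr_ae (.of_forall fun x => ?_)
  have h1 : (0 : ℝ) ≤ weight x := (Real.exp_pos _).le
  have h2 : rescaledSum x = (1 / (n : ℝ) ^ (1 / 4 : ℝ)) • normSum x := rfl
  simp only [ENNReal.toReal_div, ENNReal.toReal_ofReal h1, h2, real_inner_smul_left,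
    Complex.real_smul]
  push_cast
  ring_nf

end Normalization

/-! ### Domination, Fourier transforms and the limit law. -/

section Limit

variable {d : ℕ} {ρ : Measure (EuclideanSpace ℝ (Fin d))} [IsProbabilityMeasure ρ]

lemma rpow_quarter_sq_sq (n : ℕ) : (((n : ℝ) ^ (1 / 4 : ℝ)) ^ 2) ^ 2 = n := by
  rw [← pow_mul, ← Real.rpow_natCast, ← Real.rpow_mul (Nat.cast_nonneg n)]; norm_num

omit [IsProbabilityMeasure ρ] in
lemma smoothedDensity_nonneg (n : ℕ) (r : ℝ) (z : EuclideanSpace ℝ (Fin d)) :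
    0 ≤ smoothedDensity ρ n r z :=
  integral_nonneg fun _ => (Real.exp_pos _).le

lemma smoothedDensity_le (hsymm : IsSymmetric ρ) {n : ℕ} (hn : 1 ≤ n)
    (z : EuclideanSpace ℝ (Fin d)) :
    smoothedDensity ρ n ((n : ℝ) ^ (1 / 4 : ℝ)) z ≤
      Real.exp (1 / 320 - 1 / 320 * ‖z‖ ^ 2) := by
  rw [smoothedDensity_eq ρ hsymm]
  refine (le_abs_self _).trans ?_
  have h := norm_setIntegral_le_of_norm_le_const
    (μ := Measure.pi fun _ : Fin n => ρ) (s := Dplus d n)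
    (f := fun x => Real.exp (-∑ i, coshGap ((n : ℝ) ^ (1 / 4 : ℝ) * inner ℝ z (normObs x i))))
    (C := Real.exp (1 / 320 - 1 / 320 * ‖z‖ ^ 2)) (measure_lt_top _ _) fun x hx => by
      rw [Real.norm_eq_abs, Real.abs_exp, Real.exp_le_exp]
      have := le_sum_coshGap hx hn (rpow_quarter_sq_sq n) z
      linarith
  refine h.trans (mul_le_of_le_one_right (Real.exp_pos _).le measureReal_le_one)

/-- The uniform bound passes to the pointwise limit, so integrability needs no direct lower bound on
M₄. -/
lemma limitWeight_le (hsymm : IsSymmetric ρ) (hnd : IsNonDegenerate ρ)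
    (h5 : Integrable (fun z => ‖z‖ ^ 5) ρ) (z : EuclideanSpace ℝ (Fin d)) :
    limitWeight ρ z ≤ Real.exp (1 / 320 - 1 / 320 * ‖z‖ ^ 2) :=
  le_of_tendsto (tendsto_smoothedDensity hsymm hnd h5 z)
    ((eventually_ge_atTop 1).mono fun _ hn => smoothedDensity_le hsymm hn z)

lemma integrable_limitWeight (hsymm : IsSymmetric ρ) (hnd : IsNonDegenerate ρ)
    (h5 : Integrable (fun z => ‖z‖ ^ 5) ρ) : Integrable (limitWeight ρ) volume := by
  refine (integrable_exp_neg_mul_sq_norm (by norm_num : (0 : ℝ) < 1 / 320) (1 / 320)).mono'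
    continuous_limitWeight.aestronglyMeasurable (.of_forall fun z => ?_)
  rw [limitWeight, Real.norm_eq_abs, Real.abs_exp]
  exact limitWeight_le hsymm hnd h5 z

lemma tendsto_integral_smoothedDensity (hsymm : IsSymmetric ρ) (hnd : IsNonDegenerate ρ)
    (h5 : Integrable (fun z => ‖z‖ ^ 5) ρ) (t : EuclideanSpace ℝ (Fin d)) :
    Tendsto (fun n : ℕ => ∫ z, Complex.exp (inner ℝ z t * Complex.I) *
        (smoothedDensity ρ n ((n : ℝ) ^ (1 / 4 : ℝ)) z : ℂ)) atTop
      (𝓝 (∫ z, Complex.exp (inner ℝ z t * Complex.I) * (limitWeight ρ z : ℂ))) := by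
  refine tendsto_integral_filter_of_dominated_convergence _ ?_ ?_
    (integrable_exp_neg_mul_sq_norm (by norm_num : (0 : ℝ) < 1 / 320) (1 / 320)) ?_
  · filter_upwards [eventually_ge_atTop 1] with n hn
    have hr : (0 : ℝ) < (n : ℝ) ^ (1 / 4 : ℝ) := Real.rpow_pos_of_pos (by exact_mod_cast hn) _
    exact (Continuous.aestronglyMeasurable (by fun_prop)).mul
      (Complex.continuous_ofReal.comp_aestronglyMeasurable
        (aestronglyMeasurable_smoothedDensity ρ hr))
  · filter_upwards [eventually_ge_atTop 1] with n hn
    refine .of_forall fun z => ?_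
    rw [norm_mul, Complex.norm_exp_ofReal_mul_I, one_mul, Complex.norm_real, Real.norm_eq_abs,
      abs_of_nonneg (smoothedDensity_nonneg _ _ _)]
    exact smoothedDensity_le hsymm hn z
  · refine .of_forall fun z => Tendsto.const_mul _ ?_
    exact (Complex.continuous_ofReal.tendsto _).comp (tendsto_smoothedDensity hsymm hnd h5 z)

omit [IsProbabilityMeasure ρ] in
lemma limitWeight_pos (z : EuclideanSpace ℝ (Fin d)) : 0 < limitWeight ρ z :=
  Real.exp_pos _

omit [IsProbabilityMeasure ρ] in
lemma integral_limitWeight_pos (hint : Integrable (limitWeight ρ) volume) :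
    0 < ∫ z, limitWeight ρ z := by
  refine (integral_pos_iff_support_of_nonneg (fun z => (limitWeight_pos z).le) hint).2 ?_
  have : Function.support (limitWeight ρ) = Set.univ :=
    Set.eq_univ_of_forall fun z => (limitWeight_pos z).ne'
  rw [this]
  exact Measure.measure_univ_pos.2 (NeZero.ne _)

omit [IsProbabilityMeasure ρ] in
lemma isProbabilityMeasure_limitLaw (hint : Integrable (limitWeight ρ) volume) :
    IsProbabilityMeasure (limitLaw ρ) := by
  have hpos := integral_limitWeight_pos hint
  refine ⟨?_⟩
  rw [limitLaw, withDensity_apply _ .univ, Measure.restrict_univ,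
    ← ofReal_integral_eq_lintegral_ofReal (hint.div_const _)
      (.of_forall fun z => div_nonneg (limitWeight_pos z).le hpos.le),
    integral_div, div_self hpos.ne', ENNReal.ofReal_one]

omit [IsProbabilityMeasure ρ] in
lemma charFun_limitLaw (hint : Integrable (limitWeight ρ) volume)
    (t : EuclideanSpace ℝ (Fin d)) :
    charFun (limitLaw ρ) t =
      (∫ z, Complex.exp (inner ℝ z t * Complex.I) * (limitWeight ρ z : ℂ)) /
        ((∫ z, limitWeight ρ z : ℝ) : ℂ) := by
  have hpos := integral_limitWeight_pos hint
  rw [charFun_apply, limitLaw, integral_withDensity_eq_integral_toReal_smul₀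
    (hint.div_const _).aemeasurable.ennreal_ofReal (.of_forall fun _ => ENNReal.ofReal_lt_top),
    ← integral_div]
  refine integral_congr_ae (.of_forall fun z => ?_)
  have h1 : 0 ≤ limitWeight ρ z / ∫ u, limitWeight ρ u :=
    div_nonneg (limitWeight_pos z).le hpos.le
  simp only [ENNReal.toReal_ofReal h1, Complex.real_smul]
  push_cast
  ring

/-- Dividing by the value at t = 0 cancels both Z_n and the Gaussian constant; the exponential in
front undoes the smoothing. -/
lemma charFun_rescaledSum_eq (hd : 1 ≤ d) (hnd : IsNonDegenerate ρ) {n : ℕ} (hn : d ≤ n)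
    (t : EuclideanSpace ℝ (Fin d)) :
    charFun ((modelMeasure ρ n).map rescaledSum) t =
      Complex.exp (‖t‖ ^ 2 / (2 * (((n : ℝ) ^ (1 / 4 : ℝ) : ℝ) : ℂ) ^ 2)) *
      ((∫ z, Complex.exp (inner ℝ z t * Complex.I) *
          (smoothedDensity ρ n ((n : ℝ) ^ (1 / 4 : ℝ)) z : ℂ)) /
        ∫ z, Complex.exp (inner ℝ z (0 : EuclideanSpace ℝ (Fin d)) * Complex.I) *
          (smoothedDensity ρ n ((n : ℝ) ^ (1 / 4 : ℝ)) z : ℂ)) := by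
  have hZ := (Z_pos hd hnd hn).ne'
  have := isProbabilityMeasure_modelMeasure hd hnd hn
  have := Measure.isProbabilityMeasure_map (aemeasurable_rescaledSum (ρ := ρ) n)
  have h0 := charFun_rescaledSum n hZ 0
  rw [charFun_zero, probReal_univ] at h0
  rw [charFun_rescaledSum n hZ]
  have hr : (0 : ℝ) < (n : ℝ) ^ (1 / 4 : ℝ) :=
    Real.rpow_pos_of_pos (by exact_mod_cast hd.trans hn) _
  rw [integral_mul_smoothedDensity ρ hr, integral_mul_smoothedDensity ρ hr]
  set r := (n : ℝ) ^ (1 / 4 : ℝ)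
  have hr' : (r : ℂ) ≠ 0 := by exact_mod_cast hr.ne'
  have hC : (2 * Real.pi / r ^ 2 : ℂ) ^ (d / 2 : ℂ) ≠ 0 := by
    rw [Ne, Complex.cpow_eq_zero_iff, not_and_or]
    left
    have : (Real.pi : ℂ) ≠ 0 := by exact_mod_cast Real.pi_ne_zero
    exact div_ne_zero (mul_ne_zero two_ne_zero this) (pow_ne_zero 2 hr')
  set C := (2 * Real.pi / r ^ 2 : ℂ) ^ (d / 2 : ℂ)
  have hw : weightedCharFun ρ n r 0 ≠ 0 := fun h => by simp [h] at h0
  have hZw : ((Z ρ n).toReal : ℂ)⁻¹ = (weightedCharFun ρ n r 0)⁻¹ :=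
    eq_inv_of_mul_eq_one_left (by exact_mod_cast h0.symm)
  rw [hZw, Complex.exp_neg]
  have := Complex.exp_ne_zero (‖t‖ ^ 2 / (2 * (r : ℂ) ^ 2))
  simp only [norm_zero, Complex.ofReal_zero, ne_eq, OfNat.ofNat_ne_zero, not_false_eq_true,
    zero_pow, zero_div, neg_zero, Complex.exp_zero, mul_one]
  field_simp

lemma tendsto_charFun_rescaledSum (hd : 1 ≤ d) (hsymm : IsSymmetric ρ) (hnd : IsNonDegenerate ρ)
    (h5 : Integrable (fun z => ‖z‖ ^ 5) ρ) (t : EuclideanSpace ℝ (Fin d)) :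
    Tendsto (fun n : ℕ => charFun ((modelMeasure ρ n).map rescaledSum) t) atTop
      (𝓝 (charFun (limitLaw ρ) t)) := by
  have hint := integrable_limitWeight hsymm hnd h5
  have hpos := integral_limitWeight_pos hint
  have h0 : (∫ z, Complex.exp (inner ℝ z (0 : EuclideanSpace ℝ (Fin d)) * Complex.I) *
      (limitWeight ρ z : ℂ)) = ((∫ z, limitWeight ρ z : ℝ) : ℂ) := by
    rw [← integral_complex_ofReal]
    simp
  have hexp : Tendsto (fun n : ℕ =>
      Complex.exp (‖t‖ ^ 2 / (2 * (((n : ℝ) ^ (1 / 4 : ℝ) : ℝ) : ℂ) ^ 2))) atTop (𝓝 1) := by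
    have hr : Tendsto (fun n : ℕ => ‖t‖ ^ 2 / (2 * ((n : ℝ) ^ (1 / 4 : ℝ)) ^ 2)) atTop (𝓝 0) :=
      (((tendsto_pow_atTop two_ne_zero).comp ((tendsto_rpow_atTop (by norm_num)).comp
        tendsto_natCast_atTop_atTop)).const_mul_atTop two_pos).const_div_atTop _
    have := (Complex.continuous_exp.comp Complex.continuous_ofReal).tendsto 0 |>.comp hr
    simp only [Function.comp_apply, Complex.ofReal_zero, Complex.exp_zero] at this
    refine this.congr fun n => ?_
    simp only [Function.comp_apply]
    push_cast
    rfl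
  have hlim := hexp.mul ((tendsto_integral_smoothedDensity hsymm hnd h5 t).div
    (tendsto_integral_smoothedDensity hsymm hnd h5 0) (by
      rw [h0]; exact_mod_cast hpos.ne'))
  rw [one_mul, h0, ← charFun_limitLaw hint] at hlim
  refine hlim.congr' ?_
  filter_upwards [eventually_ge_atTop d] with n hn
  rw [charFun_rescaledSum_eq hd hnd hn]
  rfl

end Limit

end SOC

theorem theorem2 (d : ℕ) (hd : 1 ≤ d) (ρ : Measure (EuclideanSpace ℝ (Fin d)))
    [IsProbabilityMeasure ρ] (hsymm : SOC.IsSymmetric ρ) (hnd : SOC.IsNonDegenerate ρ)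
    (h5 : Integrable (fun z => ‖z‖ ^ 5) ρ) :
    -- the objects are well defined
    (∀ n : ℕ, d ≤ n → 0 < SOC.Z ρ n ∧ SOC.Z ρ n < ∞) ∧
    (SOC.covMat ρ).PosDef ∧
    Integrable (SOC.limitWeight ρ) volume ∧
    -- convergence in distribution of the rescaled sum under the model
    ∃ (_ : ∀ n : {n : ℕ // d ≤ n}, IsProbabilityMeasure (SOC.modelMeasure ρ n.1))
      (_ : IsProbabilityMeasure (SOC.limitLaw ρ)),
      TendstoInDistribution
        (fun n : {n : ℕ // d ≤ n} =>
          (SOC.rescaledSum : (Fin n.1 → EuclideanSpace ℝ (Fin d)) → EuclideanSpace ℝ (Fin d)))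
        atTop (fun z : EuclideanSpace ℝ (Fin d) => z)
        (fun n : {n : ℕ // d ≤ n} => SOC.modelMeasure ρ n.1) (SOC.limitLaw ρ) := by
  have hint := SOC.integrable_limitWeight hsymm hnd h5
  have hmodel : ∀ n : {n : ℕ // d ≤ n}, IsProbabilityMeasure (SOC.modelMeasure ρ n.1) :=
    fun n => SOC.isProbabilityMeasure_modelMeasure hd hnd n.2
  have hlaw := SOC.isProbabilityMeasure_limitLaw hint
  refine ⟨fun n hn => ⟨SOC.Z_pos hd hnd hn, SOC.Z_lt_top n⟩, SOC.posDef_covMat h5 hnd, hint,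
    hmodel, hlaw, ⟨fun n => SOC.aemeasurable_rescaledSum n.1, by fun_prop, ?_⟩⟩
  set F : {n : ℕ // d ≤ n} → ProbabilityMeasure (EuclideanSpace ℝ (Fin d)) := fun n =>
    ⟨(SOC.modelMeasure ρ n.1).map SOC.rescaledSum,
      Measure.isProbabilityMeasure_map (SOC.aemeasurable_rescaledSum n.1)⟩ with hF
  -- Lévy's theorem is applied along ℕ after a shift by d, then carried back to the indices n ≥ d by
  -- n ↦ n - d.
  have hseq : Tendsto (fun k : ℕ => F ⟨k + d, Nat.le_add_left d k⟩) atTop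
      (𝓝 ⟨(SOC.limitLaw ρ).map fun z => z,
        Measure.isProbabilityMeasure_map aemeasurable_id'⟩) := by
    refine ProbabilityMeasure.tendsto_iff_tendsto_charFun.2 fun t => ?_
    simp only [ProbabilityMeasure.coe_mk, Measure.map_id', hF]
    exact (SOC.tendsto_charFun_rescaledSum hd hsymm hnd h5 t).comp (tendsto_add_atTop_nat d)
  have hsub : Tendsto (fun n : {n : ℕ // d ≤ n} => n.1 - d) atTop atTop :=
    tendsto_atTop_atTop.2 fun b => ⟨⟨b + d, Nat.le_add_left d b⟩, fun n hn => by
      have : b + d ≤ n.1 := hn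
      omega⟩
  refine (hseq.comp hsub).congr fun n => ?_
  have : (⟨n.1 - d + d, Nat.le_add_left d (n.1 - d)⟩ : {n : ℕ // d ≤ n}) = n :=
    Subtype.ext (Nat.sub_add_cancel n.2)
  simp only [Function.comp_apply, this]
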